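/- Let $Z=(Z_H(t))_{(t,H)\in[0,\infty)\times(0,1)}$ be a fractional Gaussian field on a probability space $(\Omega,\mathcal F,\mathbb P)$, i.e. a centered Gaussian process with $$\mathbb E[Z_H(t)Z_{H'}(s)]=\tfrac{a_{H,H'}}{2}\left(t^{H+H'}+s^{H+H'}-|t-s|^{H+H'}\right),$$ where $$a_{H,H'}=-\tfrac2\pi\sqrt{\Gamma(2H+1)\sin(\pi H)}\sqrt{\Gamma(2H'+1)\sin(\pi H')}\;\Gamma(-(H+H'))\cos\left((H'-H)\tfrac\pi2\right)\cos\left((H+H')\tfrac\pi2\right)$$ if $H+H'\neq1$, and $a_{H,H'}=a_H:=\sqrt{\Gamma(2H+1)\Gamma(3-2H)}\,\sin^2(\pi H)$ if $H+H'=1$. Fix $H\in(0,1)$. Let $\mathcal F^H_t=\sigma(Z_H(r):0\le r\le t)$, let $(M_t)_{t\ge0}$ be an almost surely continuous version of $M_H(t)=\mathbb E[Z_{1-H}(t)\mid\mathcal F^H_t]$, and put $$c_M=\frac{a_H^2\,\Gamma(3/2-H)}{2H\,\Gamma(H+1/2)\,\Gamma(3-2H)},\qquad c_\Psi=\frac{2H\,\Gamma(3-2H)\,\Gamma(H+1/2)}{a_H\,\Gamma(3/2-H)},\qquad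 C=c_\Psi\sqrt{c_M(2-2H)}.$$ The Dobrić–Ojeda process is $V_t=V_H(t)=c_\Psi t^{2H-1}M_t$ for $t>0$, with $V_0=0$ (almost surely). Let $W$ be the Brownian motion driving $M$, given by $dM_t=\sqrt{c_M(2-2H)}\;t^{1/2-H}\,dW_t$, i.e. $W_t=\int_0^t \left(c_M(2-2H)\right)^{-1/2}s^{H-1/2}\,dM_s$. For $\epsilon>0$ the modified Dobrić–Ojeda process is $$V^\epsilon_t=\int_0^t C s^{H-1/2}\,dW_s+\int_0^t c_\Psi(2H-1)s^{2H-2}M_s\,\mathbf 1_{[\epsilon,\infty)}(s)\,ds,\qquad t\ge0,$$ where one fixed almost surely continuous version of the stochastic integral $\int_0^t Cs^{H-1/2}\,dW_s$ is used for all $\epsilon$. Then, as $\epsilon\downarrow0$, $V^\epsilon$ converges to $V$ uniformly in $t\in[0,\infty)$, both in $L^2(\Omega)$ and almost surely: for every $\epsilon>0$ the function $\sup_{t\ge0}|V^\epsilon_t-V_t|$ is ($\mathbb P$-almost everywhere) measurable, $$\lim_{\epsilon\downarrow0}\mathbb E\left[\sup_{t\ge0}|V^\epsilon_t-V_t|^2\right]=0,$$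 and, almost surely, $\lim_{\epsilon\downarrow0}\sup_{t\ge0}|V^\epsilon_t-V_t|=0$. -/

import Mathlib

open MeasureTheory ProbabilityTheory Filter Topology
open scoped NNReal ENNReal

noncomputable section

namespace DobricOjeda

/-- The Hurst parameters `H ∈ (0,1)`. -/
abbrev Hurst : Type := Set.Ioo (0 : ℝ) 1

/-- The conjugate Hurst parameter `H' = 1 - H`. -/
def Hurst.dual (H : Hurst) : Hurst :=
  ⟨1 - (H : ℝ), by have h := H.2; constructor <;> [linarith [h.2]; linarith [h.1]]⟩

/-- The coefficient `a_{H,H'}` of the covariance of the fractional Gaussian field. -/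
def fieldCoeff (H H' : ℝ) : ℝ :=
  if H + H' = 1 then
    √(Real.Gamma (2 * H + 1) * Real.Gamma (3 - 2 * H)) * Real.sin (Real.pi * H) ^ 2
  else
    -(2 / Real.pi) * √(Real.Gamma (2 * H + 1) * Real.sin (Real.pi * H))
      * √(Real.Gamma (2 * H' + 1) * Real.sin (Real.pi * H'))
      * Real.Gamma (-(H + H')) * Real.cos ((H' - H) * (Real.pi / 2))
      * Real.cos ((H + H') * (Real.pi / 2))

/-- `a_H = a_{H,1-H}`. -/
def aCoeff (H : ℝ) : ℝ := fieldCoeff H (1 - H)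

/-- `c_M = a_H² Γ(3/2-H) / (2H Γ(H+1/2) Γ(3-2H))`. -/
def cM (H : ℝ) : ℝ :=
  aCoeff H ^ 2 * Real.Gamma (3 / 2 - H) /
    (2 * H * Real.Gamma (H + 1 / 2) * Real.Gamma (3 - 2 * H))

/-- `c_Ψ = 2H Γ(3-2H) Γ(H+1/2) / (a_H Γ(3/2-H))`. -/
def cPsi (H : ℝ) : ℝ :=
  2 * H * Real.Gamma (3 - 2 * H) * Real.Gamma (H + 1 / 2) /
    (aCoeff H * Real.Gamma (3 / 2 - H))

/-- `C = c_Ψ √(c_M (2-2H))`. -/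
def diffusionC (H : ℝ) : ℝ := cPsi H * √(cM H * (2 - 2 * H))

variable {Ω : Type*} {mΩ : MeasurableSpace Ω}

/-- A fractional Gaussian field `(Z_H(t))`, `(t,H) ∈ [0,∞) × (0,1)`: a centered Gaussian process
with `E[Z_H(t) Z_{H'}(s)] = (a_{H,H'}/2) (t^{H+H'} + s^{H+H'} - |t-s|^{H+H'})`. -/
structure IsFractionalGaussianField (Z : ℝ≥0 × Hurst → Ω → ℝ) (P : Measure Ω) : Prop where
  measurable : ∀ p, Measurable (Z p)
  gaussian : IsGaussianProcess Z P
  centered : ∀ p, ∫ ω, Z p ω ∂P = 0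
  covariance : ∀ (t s : ℝ≥0) (H H' : Hurst),
    ∫ ω, Z (t, H) ω * Z (s, H') ω ∂P =
      fieldCoeff (H : ℝ) (H' : ℝ) / 2 *
        ((t : ℝ) ^ ((H : ℝ) + (H' : ℝ)) + (s : ℝ) ^ ((H : ℝ) + (H' : ℝ))
          - |(t : ℝ) - (s : ℝ)| ^ ((H : ℝ) + (H' : ℝ)))

/-- `𝓕_t^H = σ(Z_H(r) : 0 ≤ r ≤ t)`. -/
@[reducible] def pastSigma (Z : ℝ≥0 × Hurst → Ω → ℝ) (H : Hurst) (t : ℝ≥0) : MeasurableSpace Ω :=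
  ⨆ r : Set.Iic t, MeasurableSpace.comap (Z ((r : ℝ≥0), H)) inferInstance

/-- `M` is (a continuous version of) the process `M_H(t) = E[Z_{1-H}(t) | 𝓕_t^H]`. -/
structure IsProjectedMartingale (Z : ℝ≥0 × Hurst → Ω → ℝ) (P : Measure Ω) (H : Hurst)
    (M : ℝ≥0 → Ω → ℝ) : Prop where
  version : ∀ t, M t =ᵐ[P] P[Z (t, H.dual) | pastSigma Z H t]
  continuous_paths : ∀ᵐ ω ∂P, Continuous fun t => M t ω

/-- Deterministic step functions `∑ᵢ cᵢ 1_{(τᵢ, τᵢ₊₁]}` on `[0,∞)`, with `τ₀ ≤ τ₁ ≤ ⋯ ≤ τₙ`. -/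
structure StepFun where
  n : ℕ
  τ : Fin (n + 1) → ℝ≥0
  mono : Monotone τ
  c : Fin n → ℝ

/-- The value `∑ᵢ cᵢ 1_{(τᵢ, τᵢ₊₁]}(s)`. -/
def StepFun.eval (φ : StepFun) (s : ℝ) : ℝ :=
  ∑ i : Fin φ.n,
    (Set.Ioc (φ.τ i.castSucc : ℝ) (φ.τ i.succ : ℝ)).indicator (fun _ => φ.c i) s

/-- The elementary integral `∫₀ᵗ φ dX = ∑ᵢ cᵢ (X_{τᵢ₊₁ ∧ t} - X_{τᵢ ∧ t})`. -/
def StepFun.integral (φ : StepFun) (X : ℝ≥0 → Ω → ℝ) (t : ℝ≥0) (ω : Ω) : ℝ :=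
  ∑ i : Fin φ.n, φ.c i * (X (min (φ.τ i.succ) t) ω - X (min (φ.τ i.castSucc) t) ω)

/-- `Y = ∫₀ᵗ f(s) dX_s`, the Itô integral of a deterministic integrand `f` against a square
integrable martingale `X` with deterministic bracket `d⟨X⟩_s = q(s) ds`: step functions converge
to `f` in `L²([0,t], q(s) ds)` and their elementary integrals converge to `Y` in `L²(P)`. -/
def IsItoIntegral (P : Measure Ω) (X : ℝ≥0 → Ω → ℝ) (q f : ℝ → ℝ) (t : ℝ≥0) (Y : Ω → ℝ) : Prop :=
  MemLp Y 2 P ∧ ∃ φ : ℕ → StepFun,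
    Tendsto (fun n => ∫⁻ s in Set.Ioc (0 : ℝ) t,
      ENNReal.ofReal ((f s - (φ n).eval s) ^ 2 * q s)) atTop (𝓝 0) ∧
    Tendsto (fun n => eLpNorm (fun ω => (φ n).integral X t ω - Y ω) 2 P) atTop (𝓝 0)

/-- The noise `W` driving `M`: `dM_t = √(c_M(2-2H)) t^{1/2-H} dW_t`, that is,
`W_t = ∫₀ᵗ (√(c_M(2-2H)))⁻¹ s^{H-1/2} dM_s`, where `d⟨M⟩_s = c_M(2-2H) s^{1-2H} ds`.
No Brownian property is assumed of `W`: it is determined by `M` up to modification. -/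
def IsDrivingNoise (P : Measure Ω) (H : Hurst) (M W : ℝ≥0 → Ω → ℝ) : Prop :=
  ∀ t, IsItoIntegral P M
    (fun s => cM H * (2 - 2 * (H : ℝ)) * s ^ (1 - 2 * (H : ℝ)))
    (fun s => (√(cM H * (2 - 2 * (H : ℝ))))⁻¹ * s ^ ((H : ℝ) - 1 / 2)) t (W t)

/-- `J` is (a continuous version of) the martingale part `J_t = ∫₀ᵗ C s^{H-1/2} dW_s`,
where `d⟨W⟩_s = ds`. -/
structure IsMartingalePart (P : Measure Ω) (H : Hurst) (W J : ℝ≥0 → Ω → ℝ) : Prop where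
  version : ∀ t, IsItoIntegral P W (fun _ => 1)
    (fun s => diffusionC H * s ^ ((H : ℝ) - 1 / 2)) t (J t)
  continuous_paths : ∀ᵐ ω ∂P, Continuous fun t => J t ω

/-- The Dobrić–Ojeda process `V_H(t) = c_Ψ t^{2H-1} M_H(t)` (equal to `0` almost surely at `t = 0`,
where `M_H(0) = 0` almost surely). -/
def originalV (H : Hurst) (M : ℝ≥0 → Ω → ℝ) (t : ℝ≥0) (ω : Ω) : ℝ :=
  cPsi H * (t : ℝ) ^ (2 * (H : ℝ) - 1) * M t ω

/-- The modified process
`V^ε_t = ∫₀ᵗ C s^{H-1/2} dW_s + ∫₀ᵗ c_Ψ (2H-1) s^{2H-2} M_s 1_{[ε,∞)}(s) ds`,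
where `J` is the first integral. -/
def modifiedV (H : Hurst) (M J : ℝ≥0 → Ω → ℝ) (ε : ℝ) (t : ℝ≥0) (ω : Ω) : ℝ :=
  J t ω + ∫ s in (0 : ℝ)..t,
    (Set.Ici ε).indicator
      (fun s => cPsi H * (2 * (H : ℝ) - 1) * s ^ (2 * (H : ℝ) - 2) * M s.toNNReal ω) s

end DobricOjeda

end

namespace DobricOjeda

/-! ### Gaussianity and conditional expectation on closed linear spans in `L²` -/

section GaussianClosure

variable {Ω : Type*} {mΩ : MeasurableSpace Ω} {P : Measure Ω}

open scoped RealInnerProductSpace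

/-! The heart of the matter is the integration by parts V_t = J_t + c_Ψ(2H-1) ∫₀ᵗ s^(2H-2) M_s ds
(`martingalePart_add_drift_ae_eq`). Given it, V^ε - V is -c_Ψ(2H-1) times the integral of s^(2H-2)
M_s over (0, min(t, ε)]. Its supremum over t is at most |c_Ψ(2H-1)| times the absolute drift up to
ε. Cauchy–Schwarz and E[M_s²] = κ s^(2-2H) bound the second moment of that drift by κ (ε^H/H)²
(`lintegral_absDrift_sq_le`), which gives the L² limit. The almost sure limit is absolute continuity
of the integral.

The covariance of M comes from Hilbert space geometry (`exists_covariance_projectedMartingale`). For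
a Gaussian field, M_t is the orthogonal projection of Z_{1-H}(t) onto the closed span of the Z_H(r),
r ≤ t. The cross covariance is linear in r because H + (1-H) = 1, so the projections are nested, and
self-similarity of Z_H fixes their norms up to one constant κ. The value of κ is never computed.

The integration by parts uses no stochastic calculus. An Itô integral of a deterministic integrand
is determined by its pairings with square integrable variables (`IsItoIntegral.integral_mul_eq`).
The defect D of the identity is first seen to be orthogonal to every M_r, r ≤ t. As D is itself
built linearly from these M_r, it is then orthogonal to itself, hence zero. -/

theorem integral_abs_le_norm [IsProbabilityMeasure P] (ξ : Lp ℝ 2 P) :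
    ∫ ω, |ξ ω| ∂P ≤ ‖ξ‖ := by
  have h1 : ∫ ω, |ξ ω| ∂P = (eLpNorm ξ 1 P).toReal := by
    rw [eLpNorm_one_eq_lintegral_enorm, ← integral_norm_eq_lintegral_enorm
      (Lp.aestronglyMeasurable ξ)]
    simp [Real.norm_eq_abs]
  rw [h1, Lp.norm_def]
  exact ENNReal.toReal_mono (Lp.eLpNorm_ne_top ξ)
    (eLpNorm_le_eLpNorm_of_exponent_le (by norm_num) (Lp.aestronglyMeasurable ξ))

theorem integral_abs_sub_le_norm [IsProbabilityMeasure P] (ξ η : Lp ℝ 2 P) :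
    ∫ ω, |ξ ω - η ω| ∂P ≤ ‖ξ - η‖ := by
  refine le_of_eq_of_le (integral_congr_ae ?_) (integral_abs_le_norm (ξ - η))
  filter_upwards [Lp.coeFn_sub ξ η] with ω h
  rw [h, Pi.sub_apply]

theorem norm_sq_eq_integral_sq (ξ : Lp ℝ 2 P) : ‖ξ‖ ^ 2 = ∫ ω, ξ ω ^ 2 ∂P := by
  rw [← real_inner_self_eq_norm_sq, L2.inner_def]
  simp [pow_two]

theorem continuous_integral_comp [IsProbabilityMeasure P] {F : Type*} [NormedAddCommGroup F]
    [NormedSpace ℝ F] {g : ℝ → F} {K : ℝ} (hg : Continuous g)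
    (hK : ∀ x y, ‖g x - g y‖ ≤ K * |x - y|) :
    Continuous fun ξ : Lp ℝ 2 P => ∫ ω, g (ξ ω) ∂P := by
  have hK0 : 0 ≤ K := by simpa using (norm_nonneg _).trans (hK 1 0)
  have hint (ξ : Lp ℝ 2 P) : Integrable (fun ω => g (ξ ω)) P := by
    have h1 : Integrable ξ P := (Lp.memLp ξ).integrable (by norm_num)
    refine Integrable.mono' ((h1.abs.const_mul K).add (integrable_const ‖g 0‖))
      (hg.comp_aestronglyMeasurable (Lp.aestronglyMeasurable ξ)) (ae_of_all _ fun ω => ?_)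
    have := norm_add_le (g (ξ ω) - g 0) (g 0)
    have h2 := hK (ξ ω) 0
    simp only [sub_add_cancel, sub_zero] at this h2
    simpa using this.trans (add_le_add_left h2 _)
  refine (LipschitzWith.of_dist_le_mul (K := K.toNNReal) fun ξ η => ?_).continuous
  rw [dist_eq_norm, dist_eq_norm, ← integral_sub (hint ξ) (hint η), Real.coe_toNNReal _ hK0]
  have hd : Integrable (fun ω => |ξ ω - η ω|) P :=
    (((Lp.memLp ξ).integrable (by norm_num)).sub ((Lp.memLp η).integrable (by norm_num))).abs
  calc ‖∫ ω, (g (ξ ω) - g (η ω)) ∂P‖ ≤ ∫ ω, K * |ξ ω - η ω| ∂P :=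
        norm_integral_le_of_norm_le (hd.const_mul K) (ae_of_all _ fun ω => hK _ _)
    _ = K * ∫ ω, |ξ ω - η ω| ∂P := integral_const_mul _ _
    _ ≤ K * ‖ξ - η‖ := mul_le_mul_of_nonneg_left (integral_abs_sub_le_norm ξ η) hK0

/-- Both sides of the characteristic function identity depend continuously on ξ in `L²`, which is
why Gaussian laws form a closed set. -/
theorem hasGaussianLaw_iff_integral_exp [IsProbabilityMeasure P] (ξ : Lp ℝ 2 P) :
    HasGaussianLaw ξ P ↔ ∀ t : ℝ, ∫ ω, Complex.exp (t * ξ ω * Complex.I) ∂P =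
      Complex.exp (((t * ∫ ω, ξ ω ∂P : ℝ) : ℂ) * Complex.I
        - ((t ^ 2 * (‖ξ‖ ^ 2 - (∫ ω, ξ ω ∂P) ^ 2) : ℝ) : ℂ) / 2) := by
  have hm := (Lp.aestronglyMeasurable ξ).aemeasurable
  rw [hasGaussianLaw_iff_charFun_map_eq hm]
  refine forall_congr' fun t => ?_
  have h1 : charFun (P.map ξ) t = ∫ ω, Complex.exp (t * ξ ω * Complex.I) ∂P := by
    rw [charFun_apply_real, integral_map hm (by fun_prop)]
  have h2 : Var[fun ω => ⟪t, ξ ω⟫; P] = t ^ 2 * (‖ξ‖ ^ 2 - (∫ ω, ξ ω ∂P) ^ 2) := by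
    have : (fun ω => ⟪t, ξ ω⟫) = fun ω => t * ξ ω := by ext; simp [mul_comm]
    rw [this, variance_const_mul, variance_eq_sub (Lp.memLp ξ), norm_sq_eq_integral_sq]
    rfl
  have h3 : (P[fun ω => ⟪t, ξ ω⟫] : ℝ) = t * ∫ ω, ξ ω ∂P := by
    rw [← integral_const_mul]; simp [mul_comm]
  rw [h1, h2, h3]

theorem isClosed_setOf_hasGaussianLaw [IsProbabilityMeasure P] :
    IsClosed {ξ : Lp ℝ 2 P | HasGaussianLaw ξ P} := by
  simp only [hasGaussianLaw_iff_integral_exp, Set.ofPred_forall]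
  refine isClosed_iInter fun t => isClosed_eq ?_ ?_
  · refine continuous_integral_comp (g := fun x : ℝ => Complex.exp (t * x * Complex.I)) (K := |t|)
      (by fun_prop) fun x y => ?_
    have : Complex.exp (t * x * Complex.I) - Complex.exp (t * y * Complex.I) =
        Complex.exp (t * y * Complex.I) * (Complex.exp (Complex.I * ((t * (x - y) : ℝ) : ℂ)) - 1) := by
      rw [mul_sub, ← Complex.exp_add]; push_cast; ring_nf
    rw [this, norm_mul]
    have h1 : ‖Complex.exp (t * y * Complex.I)‖ = 1 := by
      exact_mod_cast Complex.norm_exp_ofReal_mul_I (t * y)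
    rw [h1, one_mul, ← abs_mul]
    exact Real.norm_exp_I_mul_ofReal_sub_one_le
  · have hI : Continuous fun ξ : Lp ℝ 2 P => ∫ ω, ξ ω ∂P :=
      continuous_integral_comp (g := fun x : ℝ => x) (K := 1) continuous_id fun x y => by simp
    fun_prop

/-- The closed linear span of the vectors `x t`, `t ∈ s`. -/
def closedSpan {E T : Type*} [NormedAddCommGroup E] [NormedSpace ℝ E] (x : T → E) (s : Set T) :
    Submodule ℝ E :=
  (Submodule.span ℝ (x '' s)).topologicalClosure

theorem coeFn_sum_smul_ae_eq {T : Type*} {X : T → Ω → ℝ} {x : T → Lp ℝ 2 P}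
    (hx : ∀ t, x t =ᵐ[P] X t) (I : Finset T) (c : T → ℝ) :
    ((∑ t ∈ I, c t • x t : Lp ℝ 2 P) : Ω → ℝ) =ᵐ[P] fun ω => ∑ t ∈ I, c t * X t ω := by
  have h1 : ∀ᵐ ω ∂P, ∀ t ∈ I, (c t • x t : Lp ℝ 2 P) ω = c t * X t ω := by
    refine (eventually_countable_ball I.countable_toSet).2 fun t _ => ?_
    filter_upwards [Lp.coeFn_smul (c t) (x t), hx t] with ω h1 h2
    rw [h1, Pi.smul_apply, h2, smul_eq_mul]
  filter_upwards [Lp.coeFn_finsetSum I fun t => c t • x t, h1] with ω h2 h3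
  rw [h2, Finset.sum_apply]
  exact Finset.sum_congr rfl h3

theorem hasGaussianLaw_of_mem_closedSpan [IsProbabilityMeasure P] {T : Type*} {X : T → Ω → ℝ}
    (hX : IsGaussianProcess X P) {x : T → Lp ℝ 2 P} (hx : ∀ t, x t =ᵐ[P] X t) {s : Set T}
    {ξ : Lp ℝ 2 P} (hξ : ξ ∈ closedSpan x s) : HasGaussianLaw ξ P := by
  suffices h : (Submodule.span ℝ (x '' s) : Set (Lp ℝ 2 P)) ⊆ {ξ | HasGaussianLaw ξ P} from
    closure_minimal h isClosed_setOf_hasGaussianLaw hξ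
  intro η hη
  obtain ⟨a, -, rfl⟩ := (Finsupp.mem_span_image_iff_linearCombination ℝ).1 hη
  have h1 : HasGaussianLaw (fun ω => ∑ t ∈ a.support, (a t * X t ω)) P :=
    (hX.smul fun t => a t).hasGaussianLaw_fun_sum
  exact h1.congr (coeFn_sum_smul_ae_eq hx a.support a).symm

theorem isGaussianProcess_of_mem_closedSpan [IsProbabilityMeasure P] {S T : Type*}
    {X : T → Ω → ℝ} (hX : IsGaussianProcess X P) {x : T → Lp ℝ 2 P} (hx : ∀ t, x t =ᵐ[P] X t)
    {s : Set T} {Y : S → Ω → ℝ} {y : S → Lp ℝ 2 P} (hy : ∀ i, y i =ᵐ[P] Y i)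
    (hmem : ∀ i, y i ∈ closedSpan x s) : IsGaussianProcess Y P := by
  classical
  have hYm (i : S) : AEMeasurable (Y i) P := (Lp.aestronglyMeasurable (y i)).aemeasurable.congr (hy i)
  refine ⟨fun I => ⟨isGaussian_of_isGaussian_map fun L => ?_⟩⟩
  have hf : AEMeasurable (fun ω => I.restrict (Y · ω)) P :=
    aemeasurable_pi_lambda _ fun i => hYm i
  rw [AEMeasurable.map_map_of_aemeasurable (by fun_prop) hf]
  -- Joint Gaussianity is tested on linear functionals. The coefficients of `L` are extended by zero
  -- outside `I` so that the combination can be indexed by `S`.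
  set c : S → ℝ := fun i => if h : i ∈ I then L (Pi.single ⟨i, h⟩ 1) else 0 with hc
  have h1 : (L ∘ fun ω => I.restrict (Y · ω)) = fun ω => ∑ i ∈ I, c i * Y i ω := by
    ext ω
    have h2 : L (I.restrict (Y · ω)) = ∑ i : I, (I.restrict (Y · ω)) i • L (fun j => if i = j then 1 else 0) :=
      LinearMap.pi_apply_eq_sum_univ (L : (I → ℝ) →ₗ[ℝ] ℝ) (I.restrict (Y · ω))
    rw [Function.comp_apply, h2, ← Finset.sum_coe_sort I fun i => c i * Y i ω]
    refine Finset.sum_congr rfl fun (i : I) _ => ?_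
    have h3 : (fun j : I => if i = j then (1 : ℝ) else 0) = Pi.single i 1 := by
      ext j; simp [Pi.single_apply, eq_comm]
    simp [hc, h3, mul_comm]
  have h4 : ∑ i ∈ I, c i • y i ∈ closedSpan x s :=
    Submodule.sum_mem _ fun i _ => Submodule.smul_mem _ _ (hmem i)
  have h5 := (hasGaussianLaw_of_mem_closedSpan hX hx h4).congr (coeFn_sum_smul_ae_eq hy I c)
  rw [h1]
  exact h5.isGaussian_map

theorem integral_eq_zero_of_mem_closedSpan [IsProbabilityMeasure P] {T : Type*} {X : T → Ω → ℝ}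
    (hX0 : ∀ t, ∫ ω, X t ω ∂P = 0) {x : T → Lp ℝ 2 P} (hx : ∀ t, x t =ᵐ[P] X t) {s : Set T}
    {ξ : Lp ℝ 2 P} (hξ : ξ ∈ closedSpan x s) : ∫ ω, ξ ω ∂P = 0 := by
  have hI : Continuous fun ξ : Lp ℝ 2 P => ∫ ω, ξ ω ∂P :=
    continuous_integral_comp (g := fun x : ℝ => x) (K := 1) continuous_id fun x y => by simp
  suffices h : (Submodule.span ℝ (x '' s) : Set (Lp ℝ 2 P)) ⊆ {ξ | ∫ ω, ξ ω ∂P = 0} from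
    closure_minimal h (isClosed_eq hI continuous_const) hξ
  intro η hη
  obtain ⟨a, -, rfl⟩ := (Finsupp.mem_span_image_iff_linearCombination ℝ).1 hη
  have h1 := integral_congr_ae (coeFn_sum_smul_ae_eq hx a.support a)
  rw [integral_finsetSum] at h1
  · exact h1.trans (by simp [integral_const_mul, hX0])
  · intro t _
    exact (((memLp_congr_ae (hx t)).1 (Lp.memLp _)).integrable (by norm_num)).const_mul _

/-- The residual `x t₀ - p` is jointly Gaussian with the conditioning family and uncorrelated with
it, hence independent of `m`. Its conditional expectation is therefore its mean, zero, while `p` is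
already `m`-measurable. -/
theorem condExp_ae_eq_of_mem_closedSpan {Ω : Type*} {m mΩ : MeasurableSpace Ω} {P : Measure Ω}
    [IsProbabilityMeasure P] {ι T : Type*} {X : T → Ω → ℝ}
    (hX : IsGaussianProcess X P) (hXm : ∀ t, Measurable (X t)) (hX0 : ∀ t, ∫ ω, X t ω ∂P = 0)
    {x : T → Lp ℝ 2 P} (hx : ∀ t, x t =ᵐ[P] X t) (r : ι → T) (t₀ : T)
    (hm : m = ⨆ i, MeasurableSpace.comap (X (r i)) inferInstance) {p : Lp ℝ 2 P}
    (hp : p ∈ closedSpan x (Set.range r)) (hperp : ∀ i, ⟪x t₀ - p, x (r i)⟫ = 0) :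
    P[X t₀ | m] =ᵐ[P] p := by
  have hle : m ≤ mΩ := hm ▸ iSup_le fun i => (hXm (r i)).comap_le
  have hpm : AEStronglyMeasurable[m] p P := by
    have h1 : closure (Submodule.span ℝ (x '' Set.range r) : Set (Lp ℝ 2 P)) ⊆
        {ξ : Lp ℝ 2 P | AEStronglyMeasurable[m] ξ P} := by
      have : Fact (m ≤ mΩ) := ⟨hle⟩
      refine closure_minimal ?_ (isClosed_aestronglyMeasurable hle)
      change (Submodule.span ℝ (x '' Set.range r)) ≤ lpMeas ℝ ℝ m 2 P
      refine Submodule.span_le.2 ?_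
      rintro _ ⟨_, ⟨i, rfl⟩, rfl⟩
      have h2 : Measurable[m] (X (r i)) :=
        by
        rw [hm]
        exact (comap_measurable (X (r i))).mono
          (le_iSup (fun i => MeasurableSpace.comap (X (r i)) inferInstance) i) le_rfl
      exact ⟨_, h2.stronglyMeasurable, hx (r i)⟩
    exact h1 hp
  obtain ⟨p', hp'm, hpp'⟩ := hpm
  have hD : Measurable fun ω => X t₀ ω - p' ω := (hXm t₀).sub (hp'm.mono hle).measurable
  have hxt : x t₀ - p =ᵐ[P] fun ω => X t₀ ω - p' ω := by
    filter_upwards [Lp.coeFn_sub (x t₀) p, hx t₀, hpp'] with ω h1 h2 h3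
    rw [h1, Pi.sub_apply, h2, h3]
  have hsub (s : Set T) : closedSpan x s ≤ closedSpan x Set.univ :=
    closure_mono (Submodule.span_mono (Set.image_mono (Set.subset_univ s)))
  have hself (t : T) : x t ∈ closedSpan x Set.univ :=
    subset_closure (Submodule.subset_span ⟨t, trivial, rfl⟩)
  have hG : IsGaussianProcess
      (Sum.elim (fun (_ : Unit) ω => X t₀ ω - p' ω) fun i => X (r i)) P := by
    refine isGaussianProcess_of_mem_closedSpan hX hx (s := Set.univ)
      (y := Sum.elim (fun _ => x t₀ - p) fun i => x (r i)) ?_ ?_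
    · rintro (_ | i)
      · exact hxt
      · exact hx _
    · rintro (_ | i)
      · exact Submodule.sub_mem _ (hself _) (hsub _ hp)
      · exact hself _
  have hL2 : MemLp (fun ω => X t₀ ω - p' ω) 2 P := (memLp_congr_ae hxt).1 (Lp.memLp _)
  have hXL2 (t : T) : MemLp (X t) 2 P := (memLp_congr_ae (hx t)).1 (Lp.memLp _)
  have hind : IndepFun (fun ω (_ : Unit) => X t₀ ω - p' ω) (fun ω i => X (r i) ω) P := by
    refine hG.indepFun_of_covariance_eq_zero (fun _ => hD.aemeasurable)
      (fun i => (hXm _).aemeasurable) fun _ i => ?_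
    rw [covariance_eq_sub hL2 (hXL2 _), hX0, mul_zero, sub_zero, ← hperp i, L2.inner_def]
    refine integral_congr_ae ?_
    filter_upwards [hxt, hx (r i)] with ω h1 h2
    rw [h1, h2]
    simp [mul_comm]
  have hind' : Indep (MeasurableSpace.comap (fun ω => X t₀ ω - p' ω) inferInstance) m P := by
    have h1 : IndepFun (fun ω => X t₀ ω - p' ω) (fun ω i => X (r i) ω) P :=
      hind.comp (measurable_pi_apply ()) measurable_id
    have h2 : m = MeasurableSpace.comap (fun ω i => X (r i) ω) MeasurableSpace.pi := by
      simp only [hm, MeasurableSpace.pi, MeasurableSpace.comap_iSup, MeasurableSpace.comap_comp]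
      rfl
    rw [h2]
    exact h1
  have h0 : ∫ ω, (X t₀ ω - p' ω) ∂P = 0 := by
    rw [integral_sub ((hXL2 _).integrable (by norm_num))
      (((memLp_congr_ae hpp').1 (Lp.memLp p)).integrable (by norm_num)), hX0,
      ← integral_congr_ae hpp', integral_eq_zero_of_mem_closedSpan hX0 hx hp, sub_zero]
  have h1 := condExp_indep_eq hD.comap_le hle (comap_measurable _).stronglyMeasurable hind'
  have h2 : P[fun ω => X t₀ ω - p' ω | m] =ᵐ[P] P[X t₀ | m] - P[p' | m] :=
    condExp_sub ((hXL2 _).integrable (by norm_num))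
      (((memLp_congr_ae hpp').1 (Lp.memLp p)).integrable (by norm_num)) m
  rw [condExp_of_stronglyMeasurable hle hp'm
    (((memLp_congr_ae hpp').1 (Lp.memLp p)).integrable (by norm_num))] at h2
  filter_upwards [h1, h2, hpp'] with ω h3 h4 h5
  rw [h3, h0, Pi.sub_apply] at h4
  rw [h5]
  linarith

end GaussianClosure

/-! ### Norms of projections onto a self-similar past -/

section Projection

open scoped RealInnerProductSpace

variable {E : Type*} [NormedAddCommGroup E] [InnerProductSpace ℝ E]

theorem inner_eq_zero_of_mem_closedSpan {T : Type*} {x : T → E} {s : Set T} {v w : E}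
    (hv : ∀ t ∈ s, ⟪v, x t⟫ = 0) (hw : w ∈ closedSpan x s) : ⟪v, w⟫ = 0 := by
  suffices h : (Submodule.span ℝ (x '' s) : Set E) ⊆ {w | ⟪v, w⟫ = 0} from
    closure_minimal h (isClosed_eq (by fun_prop) continuous_const) hw
  intro η hη
  obtain ⟨a, ha, rfl⟩ := (Finsupp.mem_span_image_iff_linearCombination ℝ).1 hη
  rw [Finsupp.linearCombination_apply, Finsupp.sum, Set.mem_ofPred_eq, inner_sum]
  exact Finset.sum_eq_zero fun t ht => by
    rw [inner_smul_right, hv t ((Finsupp.mem_supported ℝ a).1 ha ht), mul_zero]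

/-- Self-similarity of the vector representing a linear functional on the past. -/
theorem rpow_mul_norm_sq_le {u : ℝ≥0 → E} {h a : ℝ}
    (hu : ∀ c r s : ℝ≥0, ⟪u (c * r), u (c * s)⟫ = (c : ℝ) ^ (2 * h) * ⟪u r, u s⟫)
    {p p' : E} {t c : ℝ≥0} (hc : 0 < c) (hp : p ∈ closedSpan u (Set.Iic t))
    (hpu : ∀ r ≤ t, ⟪p, u r⟫ = a * r) (hp' : ∀ r ≤ c * t, ⟪p', u r⟫ = a * r) :
    (c : ℝ) ^ (2 - 2 * h) * ‖p‖ ^ 2 ≤ ‖p'‖ ^ 2 := by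
  have hc' : (0 : ℝ) < c := hc
  -- Expand ‖p' - b ξ_c‖² ≥ 0, where ξ_c is ξ with its times dilated by c. The choice b = c^(1-2h)
  -- makes the linear and quadratic terms scale by the same factor b c = c^(2-2h). The bound is
  -- optimal at ξ = p.
  have key : ∀ ξ ∈ closedSpan u (Set.Iic t),
      (c : ℝ) ^ (2 - 2 * h) * (2 * ⟪p, ξ⟫ - ⟪ξ, ξ⟫) ≤ ‖p'‖ ^ 2 := by
    suffices H : (Submodule.span ℝ (u '' Set.Iic t) : Set E) ⊆
        {ξ | (c : ℝ) ^ (2 - 2 * h) * (2 * ⟪p, ξ⟫ - ⟪ξ, ξ⟫) ≤ ‖p'‖ ^ 2} from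
      fun ξ hξ => closure_minimal H (isClosed_le (by fun_prop) continuous_const) hξ
    intro η hη
    obtain ⟨x, hx, rfl⟩ := (Finsupp.mem_span_image_iff_linearCombination ℝ).1 hη
    have hx' : ∀ r ∈ x.support, r ≤ t := fun r hr => (Finsupp.mem_supported ℝ x).1 hx hr
    rw [Finsupp.linearCombination_apply, Finsupp.sum, Set.mem_ofPred_eq]
    set b : ℝ := (c : ℝ) ^ (1 - 2 * h) with hb
    have h1 : ⟪p', ∑ r ∈ x.support, x r • u (c * r)⟫ = c * ⟪p, ∑ r ∈ x.support, x r • u r⟫ := by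
      simp only [inner_sum, inner_smul_right, Finset.mul_sum]
      refine Finset.sum_congr rfl fun r hr => ?_
      rw [hp' _ (mul_le_mul_right (hx' r hr) c), hpu _ (hx' r hr)]
      push_cast; ring
    have h2 : ⟪∑ r ∈ x.support, x r • u (c * r), ∑ r ∈ x.support, x r • u (c * r)⟫ =
        (c : ℝ) ^ (2 * h) * ⟪∑ r ∈ x.support, x r • u r, ∑ r ∈ x.support, x r • u r⟫ := by
      simp only [inner_sum, sum_inner, inner_smul_right, inner_smul_left, Finset.mul_sum, hu]
      refine Finset.sum_congr rfl fun r _ => Finset.sum_congr rfl fun s _ => by ring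
    have h3 := real_inner_self_nonneg (x := p' - b • ∑ r ∈ x.support, x r • u (c * r))
    rw [real_inner_sub_sub_self, real_inner_smul_right, real_inner_smul_left, real_inner_smul_right,
      h1, h2, real_inner_self_eq_norm_sq p'] at h3
    have h4 : (c : ℝ) ^ (2 - 2 * h) = b * c := by
      rw [hb, ← Real.rpow_add_one hc'.ne']; congr 1; ring
    have h5 : b * (c : ℝ) ^ (2 * h) = c := by
      rw [hb, ← Real.rpow_add hc']; simp
    rw [h4]
    linear_combination h3 + (b * ⟪∑ r ∈ x.support, x r • u r, ∑ r ∈ x.support, x r • u r⟫) * h5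
  have h1 := key p hp
  rw [real_inner_self_eq_norm_sq] at h1
  linarith

/-- For r ≤ s the increment `p s - p r` is orthogonal to the past of r, so only the norms matter.
Dilating by t and by 1/t in `rpow_mul_norm_sq_le` gives the two inequalities for them. -/
theorem inner_projection_eq {u p : ℝ≥0 → E} {h a : ℝ} (hh : h < 1)
    (hu : ∀ c r s : ℝ≥0, ⟪u (c * r), u (c * s)⟫ = (c : ℝ) ^ (2 * h) * ⟪u r, u s⟫)
    (hp : ∀ t, p t ∈ closedSpan u (Set.Iic t)) (hpu : ∀ t, ∀ r ≤ t, ⟪p t, u r⟫ = a * r)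
    (r s : ℝ≥0) : ⟪p r, p s⟫ = ‖p 1‖ ^ 2 * ((min r s : ℝ≥0) : ℝ) ^ (2 - 2 * h) := by
  have hle (r s : ℝ≥0) (hrs : r ≤ s) : ⟪p r, p s⟫ = ⟪p r, p r⟫ := by
    have h1 : ⟪p s - p r, p r⟫ = 0 := inner_eq_zero_of_mem_closedSpan
      (fun x hx => by rw [inner_sub_left, hpu s x (le_trans hx hrs), hpu r x hx, sub_self]) (hp r)
    rw [inner_sub_left, real_inner_comm] at h1
    linarith
  have hsq (t : ℝ≥0) : ⟪p t, p t⟫ = ‖p 1‖ ^ 2 * (t : ℝ) ^ (2 - 2 * h) := by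
    rcases eq_or_ne t 0 with rfl | ht
    · rw [NNReal.coe_zero, Real.zero_rpow (by linarith), mul_zero]
      refine inner_eq_zero_of_mem_closedSpan (fun x hx => ?_) (hp 0)
      have hx0 : x = 0 := le_antisymm hx zero_le
      rw [hpu 0 x hx, hx0]; simp
    · have ht' : (0 : ℝ) < t := lt_of_le_of_ne t.2 fun h => ht (NNReal.eq h.symm)
      rw [real_inner_self_eq_norm_sq, mul_comm]
      refine le_antisymm ?_ ?_
      · have h1 := rpow_mul_norm_sq_le hu (c := t⁻¹) (p' := p 1) (by positivity) (hp t) (hpu t)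
          (by rw [inv_mul_cancel₀ ht]; exact hpu 1)
        rw [NNReal.coe_inv, Real.inv_rpow ht'.le] at h1
        rwa [inv_mul_le_iff₀ (by positivity)] at h1
      · exact rpow_mul_norm_sq_le hu (c := t) (p' := p t) (by positivity) (hp 1) (hpu 1)
          (by rw [mul_one]; exact hpu t)
  rcases le_total r s with hrs | hrs
  · rw [hle r s hrs, min_eq_left hrs, hsq]
  · rw [real_inner_comm, hle s r hrs, min_eq_right hrs, hsq]

end Projection

/-! ### Covariance of the projected martingale -/

section Martingale

open scoped RealInnerProductSpace

variable {Ω : Type*} {mΩ : MeasurableSpace Ω} {P : Measure Ω} [IsProbabilityMeasure P]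

theorem exists_covariance_projectedMartingale {Z : ℝ≥0 × Hurst → Ω → ℝ}
    (hZ : IsFractionalGaussianField Z P) {H : Hurst} {M : ℝ≥0 → Ω → ℝ}
    (hM : IsProjectedMartingale Z P H M) :
    (∀ t, MemLp (M t) 2 P) ∧ ∃ κ : ℝ, ∀ r s : ℝ≥0,
      ∫ ω, M r ω * M s ω ∂P = κ * ((min r s : ℝ≥0) : ℝ) ^ (2 - 2 * (H : ℝ)) := by
  have hL2 (q) : MemLp (Z q) 2 P := (hZ.gaussian.hasGaussianLaw_eval q).memLp_two
  set z : ℝ≥0 × Hurst → Lp ℝ 2 P := fun q => (hL2 q).toLp with hz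
  have hzZ (q) : z q =ᵐ[P] Z q := (hL2 q).coeFn_toLp
  have hinner (q q') : ⟪z q, z q'⟫ = ∫ ω, Z q ω * Z q' ω ∂P := by
    rw [L2.inner_def]
    refine integral_congr_ae ?_
    filter_upwards [hzZ q, hzZ q'] with ω h1 h2
    rw [h1, h2]; simp [mul_comm]
  set u : ℝ≥0 → Lp ℝ 2 P := fun r => z (r, H) with hu
  have hspan (t : ℝ≥0) : closedSpan z (Set.range fun r : Set.Iic t => ((r : ℝ≥0), H)) =
      closedSpan u (Set.Iic t) := by
    have : z '' (Set.range fun r : Set.Iic t => ((r : ℝ≥0), H)) = u '' Set.Iic t := by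
      ext; simp [hu]
    rw [closedSpan, closedSpan, this]
  have hproj (t : ℝ≥0) : ∃ p ∈ closedSpan u (Set.Iic t), ∀ r ≤ t, ⟪z (t, H.dual) - p, u r⟫ = 0 := by
    have : CompleteSpace (closedSpan u (Set.Iic t)) :=
      (Submodule.isClosed_topologicalClosure _).completeSpace_coe
    refine ⟨(closedSpan u (Set.Iic t)).starProjection (z (t, H.dual)),
      Submodule.starProjection_apply_mem _ _, fun r hr => ?_⟩
    exact Submodule.starProjection_inner_eq_zero _ _
      (subset_closure (Submodule.subset_span ⟨r, hr, rfl⟩))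
  choose p hp hperp using hproj
  have hMp (t : ℝ≥0) : M t =ᵐ[P] p t :=
    (hM.version t).trans (condExp_ae_eq_of_mem_closedSpan hZ.gaussian hZ.measurable hZ.centered hzZ
      (fun r : Set.Iic t => ((r : ℝ≥0), H)) (t, H.dual) rfl (by rw [hspan]; exact hp t)
      fun r => hperp t r r.2)
  refine ⟨fun t => (memLp_congr_ae (hMp t)).2 (Lp.memLp _), ‖p 1‖ ^ 2, fun r s => ?_⟩
  rw [← inner_projection_eq (a := fieldCoeff H.dual H) H.2.2 (u := u) ?_ hp ?_ r s, L2.inner_def]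
  · refine integral_congr_ae ?_
    filter_upwards [hMp r, hMp s] with ω h1 h2
    rw [h1, h2]; simp [mul_comm]
  · intro c r s
    simp only [hu, hinner, hZ.covariance]
    have h1 : |((c * r : ℝ≥0) : ℝ) - ((c * s : ℝ≥0) : ℝ)| = c * |(r : ℝ) - s| := by
      push_cast; rw [← mul_sub, abs_mul, abs_of_nonneg c.coe_nonneg]
    rw [h1, ← two_mul, NNReal.coe_mul, NNReal.coe_mul, Real.mul_rpow c.coe_nonneg r.coe_nonneg,
      Real.mul_rpow c.coe_nonneg s.coe_nonneg, Real.mul_rpow c.coe_nonneg (abs_nonneg _)]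
    ring
  · intro t r hr
    have h1 := hperp t r hr
    rw [inner_sub_left, sub_eq_zero] at h1
    have h2 : (H.dual : ℝ) + H = 1 := by simp [Hurst.dual]
    have hr' : (r : ℝ) ≤ t := hr
    rw [← h1, hu, hinner, hZ.covariance, h2, Real.rpow_one, Real.rpow_one, Real.rpow_one,
      abs_of_nonneg (by linarith)]
    ring

end Martingale

/-! ### Itô integrals of deterministic functions, tested against `L²` variables -/

section ItoDuality

theorem tendsto_integral_mul_of_eLpNorm {α : Type*} {mα : MeasurableSpace α} {μ : Measure α}
    {F : ℕ → α → ℝ} {f g : α → ℝ} (hF : ∀ n, AEStronglyMeasurable (F n) μ)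
    (hf : AEStronglyMeasurable f μ) (hg : MemLp g 2 μ) (hFg : ∀ n, Integrable (fun x => F n x * g x) μ)
    (hlim : Tendsto (fun n => eLpNorm (fun x => F n x - f x) 2 μ) atTop (𝓝 0)) :
    Tendsto (fun n => ∫ x, F n x * g x ∂μ) atTop (𝓝 (∫ x, f x * g x ∂μ)) := by
  have hbound (n : ℕ) : ∫⁻ x, ‖F n x * g x - f x * g x‖ₑ ∂μ ≤
      eLpNorm (fun x => F n x - f x) 2 μ * eLpNorm g 2 μ := by
    have h1 := eLpNorm_smul_le_mul_eLpNorm (p := 2) (q := 2) (r := 1) hg.1 ((hF n).sub hf)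
    rw [eLpNorm_one_eq_lintegral_enorm] at h1
    refine le_of_eq_of_le (lintegral_congr fun x => ?_) h1
    simp [sub_mul]
  have hzero : Tendsto (fun n => ∫⁻ x, ‖F n x * g x - f x * g x‖ₑ ∂μ) atTop (𝓝 0) := by
    refine tendsto_of_tendsto_of_tendsto_of_le_of_le tendsto_const_nhds ?_ (fun _ => zero_le)
      hbound
    simpa using ENNReal.Tendsto.mul_const hlim (Or.inr hg.eLpNorm_ne_top)
  -- Since `f` is not assumed square integrable, integrability of the limit product is recovered
  -- from one `F n` at finite distance.
  have hfg : Integrable (fun x => f x * g x) μ := by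
    obtain ⟨n, hn⟩ := (hzero.eventually (gt_mem_nhds ENNReal.zero_lt_top)).exists
    have h1 : Integrable (fun x => F n x * g x - f x * g x) μ :=
      ⟨((hF n).mul hg.1).sub (hf.mul hg.1), hn⟩
    have h2 := (hFg n).sub h1
    refine h2.congr (ae_of_all _ fun x => by simp)
  exact tendsto_integral_of_L1 _ hfg.aestronglyMeasurable (Eventually.of_forall hFg) hzero

theorem tendsto_eLpNorm_two_of_lintegral_sq {α : Type*} {mα : MeasurableSpace α} {μ : Measure α}
    {ι : Type*} {l : Filter ι} {F : ι → α → ℝ}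
    (h : Tendsto (fun i => ∫⁻ x, ‖F i x‖ₑ ^ 2 ∂μ) l (𝓝 0)) :
    Tendsto (fun i => eLpNorm (F i) 2 μ) l (𝓝 0) := by
  have h1 : Tendsto (fun i => (∫⁻ x, ‖F i x‖ₑ ^ 2 ∂μ) ^ (2⁻¹ : ℝ)) l (𝓝 (0 ^ (2⁻¹ : ℝ))) :=
    (ENNReal.continuous_rpow_const.tendsto 0).comp h
  rw [ENNReal.zero_rpow_of_pos (by norm_num)] at h1
  refine h1.congr fun i => ?_
  rw [eLpNorm_eq_lintegral_rpow_enorm_toReal (by norm_num) (by norm_num)]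
  simp

theorem StepFun.measurable_eval (φ : StepFun) : Measurable φ.eval :=
  Finset.measurable_fun_sum _ fun _ _ => measurable_const.indicator measurableSet_Ioc

theorem StepFun.abs_eval_le (φ : StepFun) (s : ℝ) : |φ.eval s| ≤ ∑ i, |φ.c i| := by
  refine (Finset.abs_sum_le_sum_abs _ _).trans (Finset.sum_le_sum fun i _ => ?_)
  rw [Set.indicator_apply]
  split_ifs <;> simp

theorem setIntegral_Ioc_min_sub {k : ℝ → ℝ} {a b t : ℝ≥0} (hab : a ≤ b)
    (hk : IntegrableOn k (Set.Ioc (0 : ℝ) t)) :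
    (∫ s in Set.Ioc (0 : ℝ) (min b t : ℝ≥0), k s) - ∫ s in Set.Ioc (0 : ℝ) (min a t : ℝ≥0), k s =
      ∫ s in Set.Ioc (0 : ℝ) t, (Set.Ioc (a : ℝ) b).indicator k s := by
  have hii (x : ℝ≥0) : IntervalIntegrable k volume 0 (min x t : ℝ≥0) := by
    rw [intervalIntegrable_iff_integrableOn_Ioc_of_le (NNReal.coe_nonneg _)]
    exact hk.mono_set (Set.Ioc_subset_Ioc_right (by exact_mod_cast min_le_right x t))
  rw [← intervalIntegral.integral_of_le (NNReal.coe_nonneg _),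
    ← intervalIntegral.integral_of_le (NNReal.coe_nonneg _),
    intervalIntegral.integral_interval_sub_left (hii b) (hii a),
    intervalIntegral.integral_of_le (by exact_mod_cast min_le_min_right t hab),
    setIntegral_indicator measurableSet_Ioc]
  congr 2
  ext s
  have ha := a.coe_nonneg
  simp only [NNReal.coe_min, Set.mem_Ioc, inf_lt_iff, le_inf_iff, Set.mem_inter_iff]
  constructor
  · rintro ⟨h1 | h1, h2, h3⟩
    · exact ⟨⟨by linarith, h3⟩, h1, h2⟩
    · linarith
  · rintro ⟨⟨h1, h2⟩, h3, h4⟩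
    exact ⟨Or.inl h3, h4, h2⟩

variable {Ω : Type*} {mΩ : MeasurableSpace Ω} {P : Measure Ω}

theorem StepFun.memLp_integral (φ : StepFun) {X : ℝ≥0 → Ω → ℝ} (hX : ∀ r, MemLp (X r) 2 P)
    (t : ℝ≥0) : MemLp (φ.integral X t) 2 P :=
  memLp_finsetSum _ fun _ _ => ((hX _).sub (hX _)).const_mul _

theorem StepFun.integral_mul_integral (φ : StepFun) {X : ℝ≥0 → Ω → ℝ} {ξ : Ω → ℝ} {k : ℝ → ℝ}
    {t : ℝ≥0} (hX : ∀ r, MemLp (X r) 2 P) (hξ : MemLp ξ 2 P)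
    (hk : IntegrableOn k (Set.Ioc (0 : ℝ) t))
    (hcov : ∀ r ≤ t, ∫ ω, X r ω * ξ ω ∂P = ∫ s in Set.Ioc (0 : ℝ) r, k s) :
    ∫ ω, φ.integral X t ω * ξ ω ∂P = ∫ s in Set.Ioc (0 : ℝ) t, φ.eval s * k s := by
  have hint (r : ℝ≥0) : Integrable (fun ω => X r ω * ξ ω) P := (hX r).integrable_mul hξ
  simp only [StepFun.integral, StepFun.eval, Finset.sum_mul]
  rw [integral_finsetSum, integral_finsetSum]
  · refine Finset.sum_congr rfl fun i _ => ?_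
    have h1 : ∀ ω, φ.c i * (X (min (φ.τ i.succ) t) ω - X (min (φ.τ i.castSucc) t) ω) * ξ ω =
        φ.c i * (X (min (φ.τ i.succ) t) ω * ξ ω - X (min (φ.τ i.castSucc) t) ω * ξ ω) :=
      fun ω => by ring
    simp only [h1]
    rw [integral_const_mul, integral_sub (hint _) (hint _), hcov _ (min_le_right _ _),
      hcov _ (min_le_right _ _), setIntegral_Ioc_min_sub (φ.mono (Fin.castSucc_le_succ i)) hk,
      ← integral_const_mul]
    refine integral_congr_ae (ae_of_all _ fun s => ?_)
    simp only [Set.indicator_apply]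
    split_ifs <;> simp
  · intro i _
    refine Integrable.bdd_mul (c := |φ.c i|) hk
      (measurable_const.indicator measurableSet_Ioc).aestronglyMeasurable (ae_of_all _ fun s => ?_)
    rw [Set.indicator_apply]
    split_ifs <;> simp
  · intro i _
    exact MemLp.integrable_mul (((hX _).sub (hX _)).const_mul _) hξ

/-- Here `m` is the density, relative to q ds, of the pairing of `X` with `ξ`. For step functions
the identity is a finite sum, and both sides pass to the limit. No martingale or bracket property of
`X` enters. The factor √q is split off to work in unweighted `L²`. -/
theorem IsItoIntegral.integral_mul_eq {X : ℝ≥0 → Ω → ℝ} {q f m : ℝ → ℝ} {t : ℝ≥0} {Y ξ : Ω → ℝ}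
    (hY : IsItoIntegral P X q f t Y) (hX : ∀ r, MemLp (X r) 2 P) (hξ : MemLp ξ 2 P)
    (hq : Measurable q) (hq0 : ∀ s ∈ Set.Ioc (0 : ℝ) t, 0 ≤ q s) (hf : Measurable f)
    (hm : Measurable m) (hmq : IntegrableOn (fun s => m s * q s) (Set.Ioc (0 : ℝ) t))
    (hm2 : IntegrableOn (fun s => m s ^ 2 * q s) (Set.Ioc (0 : ℝ) t))
    (hcov : ∀ r ≤ t, ∫ ω, X r ω * ξ ω ∂P = ∫ s in Set.Ioc (0 : ℝ) r, m s * q s) :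
    ∫ ω, Y ω * ξ ω ∂P = ∫ s in Set.Ioc (0 : ℝ) t, f s * (m s * q s) := by
  obtain ⟨hY2, φ, hφ, hφY⟩ := hY
  have hlim1 := tendsto_integral_mul_of_eLpNorm (fun n => ((φ n).memLp_integral hX t).1) hY2.1 hξ
    (fun n => ((φ n).memLp_integral hX t).integrable_mul hξ) hφY
  simp only [(φ _).integral_mul_integral hX hξ hmq hcov] at hlim1
  have hsqrt : ∀ s ∈ Set.Ioc (0 : ℝ) t, ∀ x y : ℝ, (x * √(q s)) * (y * √(q s)) = x * (y * q s) := by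
    intro s hs x y
    have := Real.mul_self_sqrt (hq0 s hs)
    linear_combination x * y * this
  have hg : MemLp (fun s => m s * √(q s)) 2 (volume.restrict (Set.Ioc (0 : ℝ) t)) := by
    refine (memLp_two_iff_integrable_sq (f := fun s => m s * √(q s))
      (hm.mul hq.sqrt).aestronglyMeasurable).2 ?_
    refine (integrableOn_congr_fun (fun s hs => ?_) measurableSet_Ioc).1 hm2
    rw [pow_two, pow_two, hsqrt s hs]; ring
  have hlim2 := tendsto_integral_mul_of_eLpNorm (μ := volume.restrict (Set.Ioc (0 : ℝ) t))
    (F := fun n s => (φ n).eval s * √(q s)) (f := fun s => f s * √(q s))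
    (fun n => ((φ n).measurable_eval.mul hq.sqrt).aestronglyMeasurable)
    (hf.mul hq.sqrt).aestronglyMeasurable hg
    (fun n => (integrableOn_congr_fun (fun s hs => (hsqrt s hs _ _).symm) measurableSet_Ioc).1
      (Integrable.bdd_mul (c := ∑ i, |(φ n).c i|) hmq
        (φ n).measurable_eval.aestronglyMeasurable (ae_of_all _ fun s => (φ n).abs_eval_le s)))
    (tendsto_eLpNorm_two_of_lintegral_sq (hφ.congr fun n =>
      setLIntegral_congr_fun measurableSet_Ioc fun s hs => by
        rw [← sub_mul, Real.enorm_eq_ofReal_abs, ← ENNReal.ofReal_pow (abs_nonneg _), sq_abs,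
          mul_pow, Real.sq_sqrt (hq0 s hs), ← neg_sub, neg_sq]))
  simp only [setIntegral_congr_fun measurableSet_Ioc fun s hs => hsqrt s hs _ _] at hlim2
  exact tendsto_nhds_unique hlim1 hlim2

end ItoDuality

/-! ### Pairings of the driving noise and of the martingale part -/

section Noise

theorem cM_pos (H : Hurst) : 0 < cM H := by
  have h0 : (0 : ℝ) < H := H.2.1
  have h1 : (H : ℝ) < 1 := H.2.2
  have ha : 0 < aCoeff H := by
    have hs : 0 < Real.sin (Real.pi * H) :=
      Real.sin_pos_of_pos_of_lt_pi (by positivity) (by nlinarith [Real.pi_pos])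
    have hg1 : 0 < Real.Gamma (2 * H + 1) := Real.Gamma_pos_of_pos (by linarith)
    have hg2 : 0 < Real.Gamma (3 - 2 * H) := Real.Gamma_pos_of_pos (by linarith)
    rw [aCoeff, fieldCoeff, if_pos (by ring)]
    positivity
  have hg1 : 0 < Real.Gamma (3 / 2 - H) := Real.Gamma_pos_of_pos (by linarith)
  have hg2 : 0 < Real.Gamma (H + 1 / 2) := Real.Gamma_pos_of_pos (by linarith)
  have hg3 : 0 < Real.Gamma (3 - 2 * H) := Real.Gamma_pos_of_pos (by linarith)
  unfold cM
  positivity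

theorem integrableOn_Ioc_rpow {p : ℝ} (hp : -1 < p) (x : ℝ≥0) :
    IntegrableOn (fun s : ℝ => s ^ p) (Set.Ioc (0 : ℝ) x) :=
  (intervalIntegrable_iff_integrableOn_Ioc_of_le x.coe_nonneg).1
    (intervalIntegral.intervalIntegrable_rpow' hp)

theorem setIntegral_Ioc_rpow {p : ℝ} (hp : -1 < p) (x : ℝ≥0) :
    ∫ s in Set.Ioc (0 : ℝ) x, s ^ p = (x : ℝ) ^ (p + 1) / (p + 1) := by
  rw [← intervalIntegral.integral_of_le x.coe_nonneg, integral_rpow (Or.inl hp),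
    Real.zero_rpow (by linarith), sub_zero]

theorem integrableOn_Ioc_indicator_rpow {p : ℝ} (hp : -1 < p) (b : ℝ) (x r : ℝ≥0) :
    IntegrableOn ((Set.Iic (r : ℝ)).indicator fun s : ℝ => b * s ^ p) (Set.Ioc (0 : ℝ) x) :=
  ((integrableOn_Ioc_rpow hp x).const_mul b).indicator measurableSet_Iic

theorem setIntegral_Ioc_indicator_rpow {p : ℝ} (hp : -1 < p) (b : ℝ) (x r : ℝ≥0) :
    ∫ s in Set.Ioc (0 : ℝ) x, (Set.Iic (r : ℝ)).indicator (fun s : ℝ => b * s ^ p) s =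
      b * (((min x r : ℝ≥0) : ℝ) ^ (p + 1) / (p + 1)) := by
  rw [setIntegral_indicator measurableSet_Iic, Set.Ioc_inter_Iic, ← setIntegral_Ioc_rpow hp,
    ← integral_const_mul, NNReal.coe_min]

variable {Ω : Type*} {mΩ : MeasurableSpace Ω} {P : Measure Ω}

/-- The hypothesis says that the pairing has density `ρ / cM H`, cut off at `r`, with respect to the
nominal bracket. Keeping `ρ` free covers both later uses: ρ = κ for testing against M_r, and ρ = 0
for a variable orthogonal to the past. No relation between κ and `cM H` is needed. -/
theorem IsDrivingNoise.integral_mul_eq {H : Hurst} {M W : ℝ≥0 → Ω → ℝ}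
    (hW : IsDrivingNoise P H M W) (hM2 : ∀ t, MemLp (M t) 2 P) {ξ : Ω → ℝ} (hξ : MemLp ξ 2 P)
    {t r : ℝ≥0} {ρ : ℝ}
    (hcov : ∀ x ≤ t, ∫ ω, M x ω * ξ ω ∂P = ρ * ((min x r : ℝ≥0) : ℝ) ^ (2 - 2 * (H : ℝ))) :
    ∫ ω, W t ω * ξ ω ∂P = ∫ s in Set.Ioc (0 : ℝ) t, (Set.Iic (r : ℝ)).indicator
      (fun s => ρ / cM H * √(cM H * (2 - 2 * (H : ℝ))) * s ^ (1 / 2 - (H : ℝ))) s := by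
  have hH0 : (0 : ℝ) < H := H.2.1
  have hH1 : (H : ℝ) < 1 := H.2.2
  have hc := cM_pos H
  have hA : 0 < cM H * (2 - 2 * (H : ℝ)) := mul_pos hc (by linarith)
  have hp : (-1 : ℝ) < 1 - 2 * H := by linarith
  have hmul (b : ℝ) (n : ℕ) (hn : n ≠ 0) :
      (fun s : ℝ => (Set.Iic (r : ℝ)).indicator (fun _ => b) s ^ n *
        (cM H * (2 - 2 * (H : ℝ)) * s ^ (1 - 2 * (H : ℝ)))) =
      (Set.Iic (r : ℝ)).indicator
        fun s => b ^ n * (cM H * (2 - 2 * (H : ℝ))) * s ^ (1 - 2 * (H : ℝ)) := by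
    ext s
    simp only [Set.indicator_apply]
    split_ifs
    · ring
    · simp [hn]
  have hmul1 := hmul (ρ / cM H) 1 one_ne_zero
  have hmul2 := hmul (ρ / cM H) 2 two_ne_zero
  simp only [pow_one] at hmul1
  rw [(hW t).integral_mul_eq (m := (Set.Iic (r : ℝ)).indicator fun _ => ρ / cM H) hM2 hξ
    (by fun_prop) (fun s hs => by have := hs.1; positivity) (by fun_prop)
    (measurable_const.indicator measurableSet_Iic)
    (by rw [hmul1]; exact integrableOn_Ioc_indicator_rpow hp _ t r)
    (by rw [hmul2]; exact integrableOn_Ioc_indicator_rpow hp _ t r) fun x hx => ?_]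
  · refine setIntegral_congr_fun measurableSet_Ioc fun s hs => ?_
    have hs0 : 0 < s := hs.1
    simp only [Set.indicator_apply]
    split_ifs
    · have h1 : s ^ (1 / 2 - (H : ℝ)) = s ^ ((H : ℝ) - 1 / 2) * s ^ (1 - 2 * (H : ℝ)) := by
        rw [← Real.rpow_add hs0]; congr 1; ring
      have h2 := Real.mul_self_sqrt hA.le
      have h3 : √(cM H * (2 - 2 * (H : ℝ))) ≠ 0 := (Real.sqrt_pos.2 hA).ne'
      rw [h1]
      nth_rewrite 2 [← h2]
      field_simp
    · simp
  · rw [hcov x hx, hmul1, setIntegral_Ioc_indicator_rpow hp]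
    have h1 : (1 - 2 * (H : ℝ) + 1) = 2 - 2 * H := by ring
    have h2 : (1 - (H : ℝ)) ≠ 0 := by linarith
    rw [h1]
    field_simp

theorem IsMartingalePart.integral_mul_eq {H : Hurst} {M W J : ℝ≥0 → Ω → ℝ}
    (hJ : IsMartingalePart P H W J) (hW : IsDrivingNoise P H M W) (hM2 : ∀ t, MemLp (M t) 2 P)
    {ξ : Ω → ℝ} (hξ : MemLp ξ 2 P) {t r : ℝ≥0} {ρ : ℝ}
    (hcov : ∀ x ≤ t, ∫ ω, M x ω * ξ ω ∂P = ρ * ((min x r : ℝ≥0) : ℝ) ^ (2 - 2 * (H : ℝ))) :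
    ∫ ω, J t ω * ξ ω ∂P = cPsi H * ρ * (2 - 2 * (H : ℝ)) * (min t r : ℝ≥0) := by
  have hH0 : (0 : ℝ) < H := H.2.1
  have hH1 : (H : ℝ) < 1 := H.2.2
  have hc := cM_pos H
  have hA : 0 < cM H * (2 - 2 * (H : ℝ)) := mul_pos hc (by linarith)
  have hsq : (fun s : ℝ => (Set.Iic (r : ℝ)).indicator
      (fun s => ρ / cM H * √(cM H * (2 - 2 * (H : ℝ))) * s ^ (1 / 2 - (H : ℝ))) s ^ 2 * 1) =ᵐ[
        volume.restrict (Set.Ioc (0 : ℝ) t)]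
      (Set.Iic (r : ℝ)).indicator fun s =>
        (ρ / cM H * √(cM H * (2 - 2 * (H : ℝ)))) ^ 2 * s ^ (1 - 2 * (H : ℝ)) := by
    filter_upwards [ae_restrict_mem measurableSet_Ioc] with s hs
    have hs0 : 0 < s := hs.1
    simp only [Set.indicator_apply]
    split_ifs
    · have h1 : s ^ (1 - 2 * (H : ℝ)) = s ^ (1 / 2 - (H : ℝ)) * s ^ (1 / 2 - (H : ℝ)) := by
        rw [← Real.rpow_add hs0]; congr 1; ring
      rw [h1]; ring
    · simp
  rw [(hJ.version t).integral_mul_eq (fun x => (hW x).1) hξ measurable_const (fun _ _ => zero_le_one)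
    (by fun_prop) (m := (Set.Iic (r : ℝ)).indicator
      fun s => ρ / cM H * √(cM H * (2 - 2 * (H : ℝ))) * s ^ (1 / 2 - (H : ℝ)))
    ((by fun_prop : Measurable _).indicator measurableSet_Iic)
    (by simp only [mul_one]; exact integrableOn_Ioc_indicator_rpow (by linarith) _ t r)
    ((integrable_congr hsq).2 (integrableOn_Ioc_indicator_rpow (by linarith) _ t r))
    fun x hx => ?_]
  · have h1 : ∀ s ∈ Set.Ioc (0 : ℝ) t, diffusionC H * s ^ ((H : ℝ) - 1 / 2) *
        ((Set.Iic (r : ℝ)).indicator (fun s => ρ / cM H * √(cM H * (2 - 2 * (H : ℝ))) *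
          s ^ (1 / 2 - (H : ℝ))) s * 1) =
        (Set.Iic (r : ℝ)).indicator
          (fun s => cPsi H * ρ * (2 - 2 * (H : ℝ)) * s ^ (0 : ℝ)) s := by
      intro s hs
      have hs0 : 0 < s := hs.1
      simp only [Set.indicator_apply]
      split_ifs
      · have h1 : s ^ (0 : ℝ) = s ^ ((H : ℝ) - 1 / 2) * s ^ (1 / 2 - (H : ℝ)) := by
          rw [← Real.rpow_add hs0]; congr 1; ring
        have h2 := Real.mul_self_sqrt hA.le
        have h3 : ρ * (2 - 2 * (H : ℝ)) = ρ / cM H * (cM H * (2 - 2 * (H : ℝ))) := by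
          field_simp
        rw [h1, diffusionC]
        linear_combination (cPsi H * s ^ ((H : ℝ) - 1 / 2) * s ^ (1 / 2 - (H : ℝ))) *
          (ρ / cM H * h2 - h3)
      · simp
    rw [setIntegral_congr_fun measurableSet_Ioc h1,
      setIntegral_Ioc_indicator_rpow (by norm_num)]
    simp
  · simp only [mul_one]
    exact hW.integral_mul_eq hM2 hξ fun y hy => hcov y (hy.trans hx)

end Noise

/-! ### The drift integral and the integration by parts -/

section Drift

variable {Ω : Type*} {mΩ : MeasurableSpace Ω} {P : Measure Ω}

theorem ennreal_lintegral_mul_sq_le {α : Type*} {mα : MeasurableSpace α} {μ : Measure α}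
    {f g : α → ℝ≥0∞} (hf : AEMeasurable f μ) (hg : AEMeasurable g μ) :
    (∫⁻ x, f x * g x ∂μ) ^ 2 ≤ (∫⁻ x, f x ^ 2 ∂μ) * ∫⁻ x, g x ^ 2 ∂μ := by
  have h1 := ENNReal.lintegral_mul_le_Lp_mul_Lq μ Real.HolderConjugate.two_two hf hg
  have h2 := pow_le_pow_left' h1 2
  rw [mul_pow, ← ENNReal.rpow_mul_natCast, ← ENNReal.rpow_mul_natCast] at h2
  simpa using h2

/-- The absolute drift `∫₀ᵗ s^{2H-2} |M_s| ds`. -/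
noncomputable def absDrift (H : Hurst) (M : ℝ≥0 → Ω → ℝ) (t : ℝ≥0) (ω : Ω) : ℝ≥0∞ :=
  ∫⁻ s in Set.Ioc (0 : ℝ) t, ‖s ^ (2 * (H : ℝ) - 2) * M s.toNNReal ω‖ₑ

theorem measurable_driftIntegrand (H : Hurst) {M : ℝ≥0 → Ω → ℝ}
    (hM : Measurable fun p : ℝ≥0 × Ω => M p.1 p.2) :
    Measurable fun p : ℝ × Ω => p.1 ^ (2 * (H : ℝ) - 2) * M p.1.toNNReal p.2 := by
  have h1 : Measurable fun p : ℝ × Ω => M p.1.toNNReal p.2 :=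
    hM.comp (measurable_fst.real_toNNReal.prodMk measurable_snd)
  fun_prop

theorem measurable_absDrift (H : Hurst) {M : ℝ≥0 → Ω → ℝ}
    (hM : Measurable fun p : ℝ≥0 × Ω => M p.1 p.2) (t : ℝ≥0) : Measurable (absDrift H M t) :=
  Measurable.lintegral_prod_left (measurable_driftIntegrand H hM).enorm

theorem lintegral_enorm_sq_of_covariance {κ e : ℝ} {M : ℝ≥0 → Ω → ℝ}
    (hM2 : ∀ t, MemLp (M t) 2 P)
    (hcov : ∀ r s : ℝ≥0, ∫ ω, M r ω * M s ω ∂P = κ * ((min r s : ℝ≥0) : ℝ) ^ e) (s : ℝ≥0) :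
    ∫⁻ ω, ‖M s ω‖ₑ ^ 2 ∂P = ENNReal.ofReal (κ * (s : ℝ) ^ e) := by
  have h1 := hcov s s
  rw [min_self] at h1
  rw [← h1, ofReal_integral_eq_lintegral_ofReal (f := fun ω => M s ω * M s ω) ((hM2 s).integrable_mul (hM2 s))
    (ae_of_all _ fun ω => mul_self_nonneg _)]
  refine lintegral_congr fun ω => ?_
  rw [Real.enorm_eq_ofReal_abs, ← ENNReal.ofReal_pow (abs_nonneg _), sq_abs, pow_two]

theorem lintegral_absDrift_sq_le [SFinite P] {H : Hurst} {M : ℝ≥0 → Ω → ℝ}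
    (hM : Measurable fun p : ℝ≥0 × Ω => M p.1 p.2) (hM2 : ∀ t, MemLp (M t) 2 P) {κ : ℝ}
    (hcov : ∀ r s : ℝ≥0,
      ∫ ω, M r ω * M s ω ∂P = κ * ((min r s : ℝ≥0) : ℝ) ^ (2 - 2 * (H : ℝ))) (t : ℝ≥0) :
    ∫⁻ ω, absDrift H M t ω ^ 2 ∂P ≤ ENNReal.ofReal ((t : ℝ) ^ (H : ℝ) / H) ^ 2 * ENNReal.ofReal κ := by
  have hH0 : (0 : ℝ) < H := H.2.1
  have hI : ∫⁻ s in Set.Ioc (0 : ℝ) t, ENNReal.ofReal (s ^ ((H : ℝ) - 1)) =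
      ENNReal.ofReal ((t : ℝ) ^ (H : ℝ) / H) := by
    rw [← ofReal_integral_eq_lintegral_ofReal (integrableOn_Ioc_rpow (by linarith) t),
      setIntegral_Ioc_rpow (by linarith)]
    · simp
    · filter_upwards [ae_restrict_mem measurableSet_Ioc] with s hs
      exact Real.rpow_nonneg hs.1.le _
  have hMm : Measurable fun p : ℝ × Ω => M p.1.toNNReal p.2 :=
    hM.comp (measurable_fst.real_toNNReal.prodMk measurable_snd)
  have hpt (ω : Ω) : absDrift H M t ω ^ 2 ≤ ENNReal.ofReal ((t : ℝ) ^ (H : ℝ) / H) *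
      ∫⁻ s in Set.Ioc (0 : ℝ) t, ENNReal.ofReal (s ^ (3 * (H : ℝ) - 3)) * ‖M s.toNNReal ω‖ₑ ^ 2 := by
    have hMω : Measurable fun s : ℝ => M s.toNNReal ω := hMm.comp (measurable_id.prodMk measurable_const)
    -- The split s^(2H-2) = s^((H-1)/2) s^((3H-3)/2) balances Cauchy–Schwarz: since E[M_s²] = κ
    -- s^(2-2H), both factors end up integrating s^(H-1), which is integrable at 0 for every H > 0.
    have h1 : absDrift H M t ω = ∫⁻ s in Set.Ioc (0 : ℝ) t, ENNReal.ofReal (s ^ (((H : ℝ) - 1) / 2)) *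
        (ENNReal.ofReal (s ^ ((3 * (H : ℝ) - 3) / 2)) * ‖M s.toNNReal ω‖ₑ) := by
      refine setLIntegral_congr_fun measurableSet_Ioc fun s hs => ?_
      have hs0 : 0 < s := hs.1
      rw [enorm_mul, ← mul_assoc, ← ENNReal.ofReal_mul (by positivity), ← Real.rpow_add hs0,
        Real.enorm_of_nonneg (by positivity)]
      congr 4; ring
    rw [h1]
    refine (ennreal_lintegral_mul_sq_le (by fun_prop) (by fun_prop)).trans (le_of_eq ?_)
    rw [← hI]
    congr 1 <;> refine setLIntegral_congr_fun measurableSet_Ioc fun s hs => ?_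
    · have hs0 : 0 < s := hs.1
      rw [← ENNReal.ofReal_pow (by positivity), ← Real.rpow_mul_natCast hs0.le]
      congr 2; push_cast; ring
    · have hs0 : 0 < s := hs.1
      rw [mul_pow, ← ENNReal.ofReal_pow (by positivity), ← Real.rpow_mul_natCast hs0.le]
      congr 3; push_cast; ring
  refine (lintegral_mono hpt).trans (le_of_eq ?_)
  rw [lintegral_const_mul' _ _ ENNReal.ofReal_ne_top, lintegral_lintegral_swap (by fun_prop), pow_two, mul_assoc]
  congr 1
  rw [← hI, ← lintegral_mul_const' _ _ ENNReal.ofReal_ne_top]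
  refine setLIntegral_congr_fun measurableSet_Ioc fun s hs => ?_
  have hs0 : 0 < s := hs.1
  rw [lintegral_const_mul' _ _ ENNReal.ofReal_ne_top, lintegral_enorm_sq_of_covariance hM2 hcov,
    ← ENNReal.ofReal_mul (by positivity), ← ENNReal.ofReal_mul (by positivity),
    Real.coe_toNNReal _ hs0.le, mul_left_comm, ← Real.rpow_add hs0, mul_comm]
  congr 3; ring

theorem ae_absDrift_lt_top [SFinite P] {H : Hurst} {M : ℝ≥0 → Ω → ℝ}
    (hM : Measurable fun p : ℝ≥0 × Ω => M p.1 p.2) (hM2 : ∀ t, MemLp (M t) 2 P) {κ : ℝ}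
    (hcov : ∀ r s : ℝ≥0,
      ∫ ω, M r ω * M s ω ∂P = κ * ((min r s : ℝ≥0) : ℝ) ^ (2 - 2 * (H : ℝ))) :
    ∀ᵐ ω ∂P, ∀ t : ℝ≥0, absDrift H M t ω < ∞ := by
  have h1 : ∀ᵐ ω ∂P, ∀ n : ℕ, absDrift H M n ω < ∞ := by
    refine ae_all_iff.2 fun n => ?_
    have h2 : ∫⁻ ω, absDrift H M n ω ^ 2 ∂P ≠ ∞ :=
      ((lintegral_absDrift_sq_le hM hM2 hcov n).trans_lt (by finiteness)).ne
    filter_upwards [ae_lt_top ((measurable_absDrift H hM n).pow_const 2) h2] with ω h3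
    simpa using h3
  filter_upwards [h1] with ω h t
  obtain ⟨n, hn⟩ := exists_nat_ge t
  exact (lintegral_mono_set (Set.Ioc_subset_Ioc_right (by exact_mod_cast hn))).trans_lt (h n)

theorem integrableOn_of_absDrift_lt_top {H : Hurst} {M : ℝ≥0 → Ω → ℝ}
    (hM : Measurable fun p : ℝ≥0 × Ω => M p.1 p.2) {t : ℝ≥0} {ω : Ω} (h : absDrift H M t ω < ∞) :
    IntegrableOn (fun s : ℝ => s ^ (2 * (H : ℝ) - 2) * M s.toNNReal ω) (Set.Ioc (0 : ℝ) t) :=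
  ⟨((measurable_driftIntegrand H hM).comp
    (measurable_id.prodMk measurable_const)).aestronglyMeasurable, h⟩

theorem memLp_drift [SFinite P] {H : Hurst} {M : ℝ≥0 → Ω → ℝ}
    (hM : Measurable fun p : ℝ≥0 × Ω => M p.1 p.2) (hM2 : ∀ t, MemLp (M t) 2 P) {κ : ℝ}
    (hcov : ∀ r s : ℝ≥0,
      ∫ ω, M r ω * M s ω ∂P = κ * ((min r s : ℝ≥0) : ℝ) ^ (2 - 2 * (H : ℝ))) (t : ℝ≥0) :
    MemLp (fun ω => ∫ s in Set.Ioc (0 : ℝ) t, s ^ (2 * (H : ℝ) - 2) * M s.toNNReal ω) 2 P := by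
  refine ⟨(StronglyMeasurable.integral_prod_left
    (measurable_driftIntegrand H hM).stronglyMeasurable).aestronglyMeasurable, ?_⟩
  rw [eLpNorm_lt_top_iff_lintegral_rpow_enorm_lt_top (by norm_num) (by norm_num)]
  refine lt_of_le_of_lt (lintegral_mono fun ω => ?_)
    ((lintegral_absDrift_sq_le hM hM2 hcov t).trans_lt (by finiteness))
  simp only [ENNReal.toReal_ofNat, ENNReal.rpow_ofNat]
  exact pow_le_pow_left' (enorm_integral_le_lintegral_enorm _) 2

theorem integral_drift_mul [SFinite P] {H : Hurst} {M : ℝ≥0 → Ω → ℝ}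
    (hM : Measurable fun p : ℝ≥0 × Ω => M p.1 p.2) (hM2 : ∀ t, MemLp (M t) 2 P) {κ : ℝ}
    (hcov : ∀ r s : ℝ≥0,
      ∫ ω, M r ω * M s ω ∂P = κ * ((min r s : ℝ≥0) : ℝ) ^ (2 - 2 * (H : ℝ))) (t : ℝ≥0)
    {ξ : Ω → ℝ} (hξ : MemLp ξ 2 P) :
    ∫ ω, (∫ s in Set.Ioc (0 : ℝ) t, s ^ (2 * (H : ℝ) - 2) * M s.toNNReal ω) * ξ ω ∂P =
      ∫ s in Set.Ioc (0 : ℝ) t, s ^ (2 * (H : ℝ) - 2) * ∫ ω, M s.toNNReal ω * ξ ω ∂P := by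
  simp only [← integral_mul_const, ← integral_const_mul, ← mul_assoc]
  refine integral_integral_swap ?_
  have hm : AEStronglyMeasurable (fun p : Ω × ℝ => p.2 ^ (2 * (H : ℝ) - 2) * M p.2.toNNReal p.1)
      (P.prod (volume.restrict (Set.Ioc (0 : ℝ) t))) :=
    ((measurable_driftIntegrand H hM).comp measurable_swap).aestronglyMeasurable
  have hm' : AEStronglyMeasurable
      (fun p : Ω × ℝ => p.2 ^ (2 * (H : ℝ) - 2) * M p.2.toNNReal p.1 * ξ p.1)
      (P.prod (volume.restrict (Set.Ioc (0 : ℝ) t))) := hm.mul hξ.1.comp_fst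
  refine ⟨hm', ?_⟩
  rw [hasFiniteIntegral_iff_enorm]
  simp only [Function.uncurry]
  rw [lintegral_prod _ hm'.enorm]
  simp only [enorm_mul _ (ξ _)]
  have h1 : ∀ ω, ∫⁻ s in Set.Ioc (0 : ℝ) t, ‖s ^ (2 * (H : ℝ) - 2) * M s.toNNReal ω‖ₑ * ‖ξ ω‖ₑ =
      absDrift H M t ω * ‖ξ ω‖ₑ := fun ω => lintegral_mul_const' _ _ enorm_ne_top
  simp only [h1]
  have h2 := ennreal_lintegral_mul_sq_le (μ := P) (measurable_absDrift H hM t).aemeasurable hξ.1.enorm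
  have h3 : ∫⁻ ω, ‖ξ ω‖ₑ ^ 2 ∂P < ∞ := by
    have := (eLpNorm_lt_top_iff_lintegral_rpow_enorm_lt_top (by norm_num) (by norm_num)).1 hξ.2
    simpa using this
  have h4 := h2.trans_lt (ENNReal.mul_lt_top
    ((lintegral_absDrift_sq_le hM hM2 hcov t).trans_lt (by finiteness)) h3)
  simpa using h4

/-- The integrand is 1 up to `r` and a pure power beyond. The factor 2H-1 stays on the left so that
H = 1/2, where the antiderivative is a logarithm, needs no separate statement. -/
theorem mul_setIntegral_rpow_mul_min {H : Hurst} {r t : ℝ≥0} (hrt : r ≤ t) :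
    (2 * (H : ℝ) - 1) * ∫ s in Set.Ioc (0 : ℝ) t, s ^ (2 * (H : ℝ) - 2) *
      ((min s.toNNReal r : ℝ≥0) : ℝ) ^ (2 - 2 * (H : ℝ)) =
    (t : ℝ) ^ (2 * (H : ℝ) - 1) * (r : ℝ) ^ (2 - 2 * (H : ℝ)) - (2 - 2 * (H : ℝ)) * r := by
  have hH0 : (0 : ℝ) < H := H.2.1
  have hH1 : (H : ℝ) < 1 := H.2.2
  rcases eq_or_ne r 0 with rfl | hr
  · simp [Real.zero_rpow (by linarith : 2 - 2 * (H : ℝ) ≠ 0)]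
  have hr0 : (0 : ℝ) < r := lt_of_le_of_ne r.2 fun h => hr (NNReal.eq h.symm)
  have hrt' : (r : ℝ) ≤ t := hrt
  have h1 : ∀ s ∈ Set.Ioc (0 : ℝ) r, s ^ (2 * (H : ℝ) - 2) *
      ((min s.toNNReal r : ℝ≥0) : ℝ) ^ (2 - 2 * (H : ℝ)) = 1 := fun s hs => by
    rw [min_eq_left (Real.toNNReal_le_iff_le_coe.2 hs.2), Real.coe_toNNReal _ hs.1.le,
      ← Real.rpow_add hs.1]
    simp
  have h2 : ∀ s ∈ Set.Ioc (r : ℝ) t, s ^ (2 * (H : ℝ) - 2) *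
      ((min s.toNNReal r : ℝ≥0) : ℝ) ^ (2 - 2 * (H : ℝ)) =
        s ^ (2 * (H : ℝ) - 2) * (r : ℝ) ^ (2 - 2 * (H : ℝ)) := fun s hs => by
    rw [min_eq_right (NNReal.le_toNNReal_of_coe_le hs.1.le)]
  have h0 : (0 : ℝ) ∉ Set.uIcc (r : ℝ) t := by
    rw [Set.uIcc_of_le hrt']; exact fun h => absurd h.1 (not_le.2 hr0)
  have hi2 : IntegrableOn (fun s : ℝ => s ^ (2 * (H : ℝ) - 2)) (Set.Ioc (r : ℝ) t) :=
    (intervalIntegrable_iff_integrableOn_Ioc_of_le hrt').1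
      (intervalIntegral.intervalIntegrable_rpow (Or.inr h0))
  have h3 : (2 * (H : ℝ) - 1) * ∫ s in Set.Ioc (r : ℝ) t, s ^ (2 * (H : ℝ) - 2) =
      (t : ℝ) ^ (2 * (H : ℝ) - 1) - (r : ℝ) ^ (2 * (H : ℝ) - 1) := by
    rcases eq_or_ne (2 * (H : ℝ) - 1) 0 with h | h
    · simp [h]
    · rw [← intervalIntegral.integral_of_le hrt', integral_rpow (Or.inr ⟨by contrapose! h; linarith, h0⟩)]
      have h4 : 2 * (H : ℝ) - 2 + 1 = 2 * H - 1 := by ring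
      rw [h4]; field_simp
  rw [← Set.Ioc_union_Ioc_eq_Ioc r.coe_nonneg hrt', setIntegral_union (Set.Ioc_disjoint_Ioc_of_le le_rfl)
    measurableSet_Ioc ((integrableOn_congr_fun h1 measurableSet_Ioc).2 (by simp))
    ((integrableOn_congr_fun h2 measurableSet_Ioc).2 (hi2.mul_const _)),
    setIntegral_congr_fun measurableSet_Ioc h1, setIntegral_congr_fun measurableSet_Ioc h2,
    integral_mul_const, mul_add, ← mul_assoc, h3]
  have h5 : (r : ℝ) ^ (2 * (H : ℝ) - 1) * (r : ℝ) ^ (2 - 2 * (H : ℝ)) = r := by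
    rw [← Real.rpow_add hr0]; ring_nf; simp
  simp only [setIntegral_const, smul_eq_mul, mul_one, Real.volume_real_Ioc_of_le r.coe_nonneg]
  linear_combination -h5

/-- Integration by parts: `V_t = ∫₀ᵗ C s^{H-1/2} dW_s + ∫₀ᵗ c_Ψ (2H-1) s^{2H-2} M_s ds`. -/
theorem martingalePart_add_drift_ae_eq [SFinite P] {H : Hurst} {M W J : ℝ≥0 → Ω → ℝ}
    (hM : Measurable fun p : ℝ≥0 × Ω => M p.1 p.2) (hM2 : ∀ t, MemLp (M t) 2 P) {κ : ℝ}
    (hcov : ∀ r s : ℝ≥0,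
      ∫ ω, M r ω * M s ω ∂P = κ * ((min r s : ℝ≥0) : ℝ) ^ (2 - 2 * (H : ℝ)))
    (hW : IsDrivingNoise P H M W) (hJ : IsMartingalePart P H W J) (t : ℝ≥0) :
    ∀ᵐ ω ∂P, J t ω + cPsi H * (2 * (H : ℝ) - 1) *
      ∫ s in Set.Ioc (0 : ℝ) t, s ^ (2 * (H : ℝ) - 2) * M s.toNNReal ω = originalV H M t ω := by
  have hH1 : (H : ℝ) < 1 := H.2.2
  set B : Ω → ℝ := fun ω => ∫ s in Set.Ioc (0 : ℝ) t, s ^ (2 * (H : ℝ) - 2) * M s.toNNReal ω with hB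
  have hB2 : MemLp B 2 P := memLp_drift hM hM2 hcov t
  have hJ2 : MemLp (J t) 2 P := (hJ.version t).1
  set D : Ω → ℝ := fun ω => J t ω + cPsi H * (2 * (H : ℝ) - 1) * B ω - originalV H M t ω with hD
  have hD2 : MemLp D 2 P := (hJ2.add (hB2.const_mul _)).sub ((hM2 t).const_mul _)
  have hexp {ξ : Ω → ℝ} (hξ : MemLp ξ 2 P) : ∫ ω, D ω * ξ ω ∂P = ∫ ω, J t ω * ξ ω ∂P +
      cPsi H * (2 * (H : ℝ) - 1) * ∫ ω, B ω * ξ ω ∂P -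
      cPsi H * (t : ℝ) ^ (2 * (H : ℝ) - 1) * ∫ ω, M t ω * ξ ω ∂P := by
    have i1 : Integrable (fun ω => J t ω * ξ ω) P := hJ2.integrable_mul hξ
    have i2 : Integrable (fun ω => B ω * ξ ω) P := hB2.integrable_mul hξ
    have i3 : Integrable (fun ω => M t ω * ξ ω) P := (hM2 t).integrable_mul hξ
    rw [← integral_const_mul, ← integral_const_mul, ← integral_add i1 (i2.const_mul _),
      ← integral_sub (f := fun ω => J t ω * ξ ω + cPsi H * (2 * (H : ℝ) - 1) * (B ω * ξ ω))
        (i1.add (i2.const_mul _)) (i3.const_mul _)]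
    refine integral_congr_ae (ae_of_all _ fun ω => ?_)
    simp only [hD, originalV]
    ring
  -- All three pairings are explicit multiples of c_Ψ κ, and they cancel by
  -- `mul_setIntegral_rpow_mul_min`.
  have horth : ∀ r ≤ t, ∫ ω, M r ω * D ω ∂P = 0 := by
    intro r hr
    simp only [mul_comm (M r _)]
    rw [hexp (hM2 r), hJ.integral_mul_eq hW hM2 (hM2 r) (t := t) (r := r) (ρ := κ) fun x _ => hcov x r,
      integral_drift_mul hM hM2 hcov t (hM2 r), hcov, min_eq_right hr]
    simp only [hcov, mul_left_comm _ κ]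
    rw [integral_const_mul]
    linear_combination cPsi H * κ * mul_setIntegral_rpow_mul_min (H := H) hr
  -- Now `D` is the test variable: by `horth` it pairs to zero with each of the three terms of which
  -- it consists, with ρ = 0 for the martingale part.
  have hDD : ∫ ω, D ω * D ω ∂P = 0 := by
    rw [hexp hD2, hJ.integral_mul_eq hW hM2 hD2 (t := t) (r := t) (ρ := 0)
      fun x hx => by rw [horth x hx, zero_mul],
      integral_drift_mul hM hM2 hcov t hD2, horth t le_rfl,
      setIntegral_congr_fun (g := fun _ => (0 : ℝ)) measurableSet_Ioc fun s hs => ?_]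
    · simp
    · simp only
      rw [horth _ (Real.toNNReal_le_iff_le_coe.2 hs.2), mul_zero]
  have h0 := (integral_eq_zero_iff_of_nonneg (fun ω => mul_self_nonneg (D ω))
    (hD2.integrable_mul hD2)).1 hDD
  filter_upwards [h0] with ω h
  have h1 : D ω = 0 := mul_self_eq_zero.1 h
  exact sub_eq_zero.1 h1

end Drift

/-! ### Measurable modifications and pathwise identities -/

section Convergence

variable {Ω : Type*} {mΩ : MeasurableSpace Ω} {P : Measure Ω}

/-- Setting the process to zero on a measurable null set makes every path continuous. Measurability
at each time then follows by limits along a dense sequence, and joint measurability from path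
continuity. Fubini for the drift requires this. -/
theorem exists_jointly_measurable_modification {M : ℝ≥0 → Ω → ℝ} (hm : ∀ t, AEMeasurable (M t) P)
    (hc : ∀ᵐ ω ∂P, Continuous fun t => M t ω) :
    ∃ N : ℝ≥0 → Ω → ℝ, (Measurable fun p : ℝ≥0 × Ω => N p.1 p.2) ∧ ∀ᵐ ω ∂P, ∀ t, N t ω = M t ω := by
  have hgood : ∀ᵐ ω ∂P, (Continuous fun t => M t ω) ∧
      ∀ n, M (TopologicalSpace.denseSeq ℝ≥0 n) ω = (hm (TopologicalSpace.denseSeq ℝ≥0 n)).mk _ ω :=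
    hc.and (ae_all_iff.2 fun n => (hm _).ae_eq_mk)
  obtain ⟨T, hT, hTm, hT0⟩ := exists_measurable_superset_of_null hgood
  have hTc : ∀ ω ∈ Tᶜ, (Continuous fun t => M t ω) ∧
      ∀ n, M (TopologicalSpace.denseSeq ℝ≥0 n) ω = (hm (TopologicalSpace.denseSeq ℝ≥0 n)).mk _ ω := fun ω hω => by
    by_contra h
    exact hω (hT h)
  set N : ℝ≥0 → Ω → ℝ := fun t => Tᶜ.indicator (M t) with hN
  have hNc (ω : Ω) : Continuous fun t => N t ω := by
    by_cases hω : ω ∈ Tᶜ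
    · simpa only [hN, Set.indicator_of_mem hω] using (hTc ω hω).1
    · simpa only [hN, Set.indicator_of_notMem hω] using continuous_const
  have hNq (n : ℕ) : Measurable (N (TopologicalSpace.denseSeq ℝ≥0 n)) := by
    have h1 : N (TopologicalSpace.denseSeq ℝ≥0 n) = Tᶜ.indicator ((hm (TopologicalSpace.denseSeq ℝ≥0 n)).mk _) :=
      Set.indicator_congr fun ω hω => (hTc ω hω).2 n
    rw [h1]
    exact (hm _).measurable_mk.indicator hTm.compl
  have hNm (t : ℝ≥0) : Measurable (N t) := by
    obtain ⟨x, hx, hxt⟩ := mem_closure_iff_seq_limit.1 (TopologicalSpace.denseRange_denseSeq ℝ≥0 t)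
    refine measurable_of_tendsto_metrizable (f := fun k => N (x k)) (fun k => ?_)
      (tendsto_pi_nhds.2 fun ω => ((hNc ω).tendsto t).comp hxt)
    obtain ⟨n, hn⟩ := hx k
    rw [← hn]
    exact hNq n
  refine ⟨N, measurable_uncurry_of_continuous_of_measurable hNc hNm, ?_⟩
  filter_upwards [measure_eq_zero_iff_ae_notMem.1 hT0] with ω hω t
  exact Set.indicator_of_mem (show ω ∈ Tᶜ from hω) _

theorem IsDrivingNoise.congr {H : Hurst} {M N W : ℝ≥0 → Ω → ℝ} (hW : IsDrivingNoise P H M W)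
    (hMN : ∀ᵐ ω ∂P, ∀ t, N t ω = M t ω) : IsDrivingNoise P H N W := by
  intro t
  obtain ⟨h1, φ, h2, h3⟩ := hW t
  refine ⟨h1, φ, h2, h3.congr fun n => eLpNorm_congr_ae ?_⟩
  filter_upwards [hMN] with ω h
  simp only [StepFun.integral, h]

theorem continuous_setIntegral_Ioc {g : ℝ → ℝ} (hg : ∀ t : ℝ≥0, IntegrableOn g (Set.Ioc (0 : ℝ) t)) :
    Continuous fun t : ℝ≥0 => ∫ s in Set.Ioc (0 : ℝ) t, g s := by
  have h1 : ∀ a b : ℝ, IntervalIntegrable ((Set.Ioi (0 : ℝ)).indicator g) volume a b := fun a b => by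
    rw [intervalIntegrable_iff, integrableOn_indicator_iff measurableSet_Ioi, Set.uIoc]
    refine (hg (max a b).toNNReal).mono_set fun s hs => ⟨hs.1, hs.2.2.trans (Real.le_coe_toNNReal _)⟩
  refine ((intervalIntegral.continuous_primitive h1 0).comp NNReal.continuous_coe).congr fun t => ?_
  rw [Function.comp_apply, intervalIntegral.integral_of_le t.coe_nonneg]
  exact setIntegral_congr_fun measurableSet_Ioc fun s hs => Set.indicator_of_mem hs.1 _

/-- Time 0 is separated because t^(2H-1) M_t is not known beforehand to be continuous there. -/
theorem eq_of_eq_on_denseSeq {f g : ℝ≥0 → ℝ} (hf : Continuous f) (hg : ContinuousOn g (Set.Ioi 0))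
    (h0 : f 0 = g 0) (h : ∀ n, f (TopologicalSpace.denseSeq ℝ≥0 n) = g (TopologicalSpace.denseSeq ℝ≥0 n)) (t : ℝ≥0) : f t = g t := by
  rcases eq_or_ne t 0 with rfl | ht
  · exact h0
  have h1 : Set.EqOn f g (Set.Ioi 0 ∩ Set.range (TopologicalSpace.denseSeq ℝ≥0)) := by
    rintro _ ⟨-, n, rfl⟩
    exact h n
  exact h1.of_subset_closure hf.continuousOn hg Set.inter_subset_left
    ((TopologicalSpace.denseRange_denseSeq ℝ≥0).open_subset_closure_inter isOpen_Ioi) (pos_iff_ne_zero.2 ht)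

theorem continuousOn_originalV {H : Hurst} {M : ℝ≥0 → Ω → ℝ} {ω : Ω}
    (hM : Continuous fun t => M t ω) : ContinuousOn (fun t => originalV H M t ω) (Set.Ioi 0) := by
  refine ContinuousOn.mul (continuousOn_const.mul ?_) hM.continuousOn
  refine NNReal.continuous_coe.continuousOn.rpow_const fun t ht => Or.inl ?_
  exact_mod_cast (ne_of_gt ht : t ≠ 0)

theorem modifiedV_sub_originalV {H : Hurst} {M J : ℝ≥0 → Ω → ℝ} {ω : Ω} {t : ℝ≥0} {ε : ℝ}
    (hint : IntegrableOn (fun s : ℝ => s ^ (2 * (H : ℝ) - 2) * M s.toNNReal ω) (Set.Ioc (0 : ℝ) t))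
    (hV : J t ω + cPsi H * (2 * (H : ℝ) - 1) *
      ∫ s in Set.Ioc (0 : ℝ) t, s ^ (2 * (H : ℝ) - 2) * M s.toNNReal ω = originalV H M t ω)
    (hε : 0 < ε) :
    modifiedV H M J ε t ω - originalV H M t ω = -(cPsi H * (2 * (H : ℝ) - 1)) *
      ∫ s in Set.Ioc (0 : ℝ) (min t ε.toNNReal : ℝ≥0), s ^ (2 * (H : ℝ) - 2) * M s.toNNReal ω := by
  have h1 : (∫ s in (0 : ℝ)..t, (Set.Ici ε).indicator
      (fun s => cPsi H * (2 * (H : ℝ) - 1) * s ^ (2 * (H : ℝ) - 2) * M s.toNNReal ω) s) =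
      cPsi H * (2 * (H : ℝ) - 1) * ∫ s in Set.Ioc (0 : ℝ) t ∩ Set.Ici ε,
        s ^ (2 * (H : ℝ) - 2) * M s.toNNReal ω := by
    rw [intervalIntegral.integral_of_le t.coe_nonneg, setIntegral_indicator measurableSet_Ici,
      ← integral_const_mul]
    simp only [mul_assoc]
  have h2 := integral_inter_add_sdiff (measurableSet_Ici (a := ε)) hint
  have h3 : (Set.Ioc (0 : ℝ) t \ Set.Ici ε : Set ℝ) =ᵐ[volume]
      Set.Ioc (0 : ℝ) (min t ε.toNNReal : ℝ≥0) := by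
    rw [Set.sdiff_eq, Set.compl_Ici, NNReal.coe_min, Real.coe_toNNReal _ hε.le, ← Set.Ioc_inter_Iic]
    exact (ae_eq_refl _).inter Iio_ae_eq_Iic
  rw [setIntegral_congr_set h3] at h2
  rw [← hV, modifiedV, h1, ← h2]
  ring

theorem tendsto_absDrift {H : Hurst} {M : ℝ≥0 → Ω → ℝ} {ω : Ω} (h : absDrift H M 1 ω < ∞) :
    Tendsto (fun ε : ℝ => absDrift H M ε.toNNReal ω) (𝓝[>] 0) (𝓝 0) := by
  have hs : Tendsto (volume.restrict (Set.Ioc (0 : ℝ) (1 : ℝ≥0)) ∘ fun ε : ℝ => Set.Ioc (0 : ℝ) ε)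
      (𝓝[>] 0) (𝓝 0) := by
    refine tendsto_of_tendsto_of_tendsto_of_le_of_le tendsto_const_nhds (h := fun ε => ENNReal.ofReal ε)
      ?_ (fun _ => zero_le) fun ε => (Measure.restrict_apply_le _ _).trans (by simp)
    have := (ENNReal.continuous_ofReal.tendsto 0).mono_left (nhdsWithin_le_nhds (s := Set.Ioi 0))
    simpa using this
  refine (tendsto_setLIntegral_zero h.ne hs).congr' ?_
  filter_upwards [Ioc_mem_nhdsGT (zero_lt_one' ℝ)] with ε hε
  rw [absDrift, Measure.restrict_restrict measurableSet_Ioc, Real.coe_toNNReal _ hε.1.le,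
    Set.inter_eq_left.2 (Set.Ioc_subset_Ioc_right (by simpa using hε.2))]

theorem iSup_eq_iSup_denseSeq {F : ℝ≥0 → ℝ≥0∞} (hF : Continuous F) :
    ⨆ t, F t = ⨆ n, F (TopologicalSpace.denseSeq ℝ≥0 n) := by
  refine le_antisymm (iSup_le fun t => ?_) (iSup_le fun n => le_iSup F _)
  have h1 : closure (Set.range (TopologicalSpace.denseSeq ℝ≥0)) ⊆ {t | F t ≤ ⨆ n, F (TopologicalSpace.denseSeq ℝ≥0 n)} := by
    refine closure_minimal ?_ (isClosed_le hF continuous_const)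
    rintro _ ⟨n, rfl⟩
    exact le_iSup (fun n => F (TopologicalSpace.denseSeq ℝ≥0 n)) n
  exact h1 (TopologicalSpace.denseRange_denseSeq ℝ≥0 t)

end Convergence

end DobricOjeda

/-! ### Uniform convergence -/

open DobricOjeda in
theorem mainTheorem10 {Ω : Type*} {mΩ : MeasurableSpace Ω} (P : Measure Ω)
    [IsProbabilityMeasure P] (Z : ℝ≥0 × DobricOjeda.Hurst → Ω → ℝ)
    (hZ : DobricOjeda.IsFractionalGaussianField Z P) (H : DobricOjeda.Hurst)
    (M W J : ℝ≥0 → Ω → ℝ)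
    (hM : DobricOjeda.IsProjectedMartingale Z P H M)
    (hW : DobricOjeda.IsDrivingNoise P H M W)
    (hJ : DobricOjeda.IsMartingalePart P H W J) :
    (∀ ε : ℝ, 0 < ε → AEMeasurable (fun ω => ⨆ t : ℝ≥0,
      ‖DobricOjeda.modifiedV H M J ε t ω - DobricOjeda.originalV H M t ω‖ₑ) P) ∧
    Tendsto (fun ε : ℝ => ∫⁻ ω, (⨆ t : ℝ≥0,
      ‖DobricOjeda.modifiedV H M J ε t ω - DobricOjeda.originalV H M t ω‖ₑ) ^ 2 ∂P)
      (𝓝[>] 0) (𝓝 0) ∧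
    ∀ᵐ ω ∂P, TendstoUniformly
      (fun (ε : ℝ) (t : ℝ≥0) => DobricOjeda.modifiedV H M J ε t ω)
      (fun t => DobricOjeda.originalV H M t ω) (𝓝[>] 0) := by
  obtain ⟨hM2, κ, hMcov⟩ := exists_covariance_projectedMartingale hZ hM
  obtain ⟨N, hN, hNM⟩ := exists_jointly_measurable_modification
    (fun t => (hM2 t).1.aemeasurable) hM.continuous_paths
  have hNMt (t : ℝ≥0) : N t =ᵐ[P] M t := by filter_upwards [hNM] with ω h using h t
  have hN2 (t : ℝ≥0) : MemLp (N t) 2 P := (memLp_congr_ae (hNMt t)).2 (hM2 t)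
  have hNcov (r s : ℝ≥0) :
      ∫ ω, N r ω * N s ω ∂P = κ * ((min r s : ℝ≥0) : ℝ) ^ (2 - 2 * (H : ℝ)) :=
    (integral_congr_ae ((hNMt r).mul (hNMt s))).trans (hMcov r s)
  have hH0 : (0 : ℝ) < H := H.2.1
  have hident (t : ℝ≥0) := martingalePart_add_drift_ae_eq hN hN2 hNcov (hW.congr hNM) hJ t
  set c : ℝ := -(cPsi H * (2 * (H : ℝ) - 1)) with hc
  have hpath : ∀ᵐ ω ∂P, (∀ t, absDrift H N t ω < ∞) ∧ ∀ ε : ℝ, 0 < ε → ∀ t : ℝ≥0,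
      modifiedV H M J ε t ω - originalV H M t ω = c * ∫ s in
        -- The identity holds almost surely at each fixed time. It is imposed at 0 and on a dense
        -- sequence, and continuity extends it to all t outside a single null set.
        Set.Ioc (0 : ℝ) (min t ε.toNNReal : ℝ≥0), s ^ (2 * (H : ℝ) - 2) * N s.toNNReal ω := by
    filter_upwards [hNM, hM.continuous_paths, hJ.continuous_paths, ae_absDrift_lt_top hN hN2 hNcov,
      hident 0, ae_all_iff.2 fun n => hident (TopologicalSpace.denseSeq ℝ≥0 n)] with ω hω hMc hJc hfin h0 hq
    have hint (t : ℝ≥0) := integrableOn_of_absDrift_lt_top hN (hfin t)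
    have hNc : Continuous fun t => N t ω := by simpa only [hω] using hMc
    have hV := eq_of_eq_on_denseSeq (hJc.add (continuous_const.mul (continuous_setIntegral_Ioc hint)))
      (continuousOn_originalV (H := H) hNc) h0 hq
    refine ⟨hfin, fun ε hε t => ?_⟩
    rw [← modifiedV_sub_originalV (hint t) (hV t) hε]
    simp only [modifiedV, originalV, hω]
  have hbound : ∀ᵐ ω ∂P, ∀ ε : ℝ, 0 < ε → ∀ t : ℝ≥0,
      ‖modifiedV H M J ε t ω - originalV H M t ω‖ₑ ≤ ‖c‖ₑ * absDrift H N ε.toNNReal ω := by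
    filter_upwards [hpath] with ω hω ε hε t
    rw [hω.2 ε hε t, enorm_mul]
    gcongr
    exact (enorm_integral_le_lintegral_enorm _).trans
      (lintegral_mono_set (Set.Ioc_subset_Ioc_right (by exact_mod_cast min_le_right _ _)))
  refine ⟨fun ε hε => ?_, ?_, ?_⟩
  -- The difference is almost surely continuous in t, so the uncountable supremum equals one over a
  -- countable dense set.
  · have hmeas : Measurable fun ω => ⨆ n, ‖c * ∫ s in
        Set.Ioc (0 : ℝ) (min (TopologicalSpace.denseSeq ℝ≥0 n) ε.toNNReal : ℝ≥0),
          s ^ (2 * (H : ℝ) - 2) * N s.toNNReal ω‖ₑ :=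
      Measurable.iSup fun n => ((StronglyMeasurable.integral_prod_left
        (measurable_driftIntegrand H hN).stronglyMeasurable).measurable.const_mul c).enorm
    refine hmeas.aemeasurable.congr ?_
    filter_upwards [hpath] with ω hω
    simp only [hω.2 ε hε]
    exact (iSup_eq_iSup_denseSeq (F := fun t => ‖c * ∫ s in
        Set.Ioc (0 : ℝ) (min t ε.toNNReal : ℝ≥0), s ^ (2 * (H : ℝ) - 2) * N s.toNNReal ω‖ₑ)
      (continuous_const.mul ((continuous_setIntegral_Ioc fun t =>
        integrableOn_of_absDrift_lt_top hN (hω.1 t)).comp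
          (continuous_id.min continuous_const))).enorm).symm
  · have hlim : Tendsto (fun ε : ℝ => ‖c‖ₑ ^ 2 *
        (ENNReal.ofReal ((ε.toNNReal : ℝ) ^ (H : ℝ) / H) ^ 2 * ENNReal.ofReal κ)) (𝓝[>] 0) (𝓝 0) := by
      have h1 : Continuous fun ε : ℝ => (ε.toNNReal : ℝ) ^ (H : ℝ) / H :=
        ((NNReal.continuous_coe.comp continuous_real_toNNReal).rpow_const
          fun _ => Or.inr hH0.le).div_const _
      have h2 : Continuous fun ε : ℝ => ‖c‖ₑ ^ 2 *
          (ENNReal.ofReal ((ε.toNNReal : ℝ) ^ (H : ℝ) / H) ^ 2 * ENNReal.ofReal κ) :=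
        (ENNReal.continuous_const_mul (by finiteness)).comp
          ((ENNReal.continuous_mul_const (by finiteness)).comp
            ((ENNReal.continuous_pow 2).comp (ENNReal.continuous_ofReal.comp h1)))
      have h3 := (h2.tendsto 0).mono_left (nhdsWithin_le_nhds (s := Set.Ioi 0))
      simpa [Real.zero_rpow hH0.ne'] using h3
    refine tendsto_of_tendsto_of_tendsto_of_le_of_le' tendsto_const_nhds hlim
      (Eventually.of_forall fun _ => zero_le) ?_
    filter_upwards [self_mem_nhdsWithin] with ε hε
    calc _ ≤ ∫⁻ ω, ‖c‖ₑ ^ 2 * absDrift H N ε.toNNReal ω ^ 2 ∂P := by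
          refine lintegral_mono_ae ?_
          filter_upwards [hbound] with ω hω
          rw [← mul_pow]
          exact pow_le_pow_left' (iSup_le fun t => hω ε hε t) 2
      _ = ‖c‖ₑ ^ 2 * ∫⁻ ω, absDrift H N ε.toNNReal ω ^ 2 ∂P :=
          lintegral_const_mul' _ _ (by finiteness)
      _ ≤ _ := by
          gcongr
          exact lintegral_absDrift_sq_le hN hN2 hNcov _
  · filter_upwards [hpath, hbound] with ω hω hωb
    have hlim : Tendsto (fun ε : ℝ => ‖c‖ₑ * absDrift H N ε.toNNReal ω) (𝓝[>] 0) (𝓝 0) := by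
      simpa using ENNReal.Tendsto.const_mul (tendsto_absDrift (hω.1 1)) (Or.inr enorm_ne_top)
    rw [Metric.tendstoUniformly_iff]
    intro e he
    filter_upwards [hlim.eventually (gt_mem_nhds (ENNReal.ofReal_pos.2 he)), self_mem_nhdsWithin]
      with ε h1 hε t
    have h2 := (hωb ε hε t).trans_lt h1
    rw [dist_comm, Real.dist_eq]
    rw [Real.enorm_eq_ofReal_abs] at h2
    exact (ENNReal.ofReal_lt_ofReal_iff he).1 h2
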